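/- **Setting.** Fix $n\in\mathbb N$, $\hbar>0$ and $p\in\mathbb C^n$. For multiindices $R,S\in\mathbb N^n$ write $\partial^R_z\partial^S_{\bar z}$ for the Wirtinger derivatives on $\mathbb C^n$. For smooth $f:\mathbb C^n\to\mathbb C$, $m\in\mathbb N$ and $0\le\ell<2^m$ define recursively $h_{m,\ell,R,S}(f)\in[0,\infty]$ by $$h_{0,0,R,S}(f)=\sum_{N\in\mathbb N^n}\frac{(2\hbar)^{|R|+|S|+|N|}}{N!}\bigl|\partial_z^R\partial_{\bar z}^{N+S}f(p)\bigr|^2,$$ $$h_{m,\ell,R,S}(f)=\sum_{N\in\mathbb N^n}\frac1{N!}\Bigl(\sum_{I\le R}\ \sum_{J\le N+S}\binom RI\binom{N+S}J\,h^{(\ell)}_{I,J}(f)\Bigr)^2\qquad(m\ge1),$$ where $h^{(\ell)}_{I,J}=h_{m-1,\ell/2,I,J}$ for even $\ell$ and $h^{(\ell)}_{I,J}=h_{m-1,(\ell-1)/2,J,I}$ for odd $\ell$, and put $\|f\|_{m,\ell,R,S}=h_{m,\ell,R,S}(f)^{1/2^{m+1}}$. Let $\mathcal A_\hbar$ be the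 vector space of all real-analytic $f:\mathbb C^n\to\mathbb C$ with $\|f\|_{m,\ell,R,S}<\infty$ for all $m,\ell,R,S$, with the locally convex topology given by these seminorms. The Wick star product is $$f\star g=\sum_{N\in\mathbb N^n}\frac{(2\hbar)^{|N|}}{N!}\,\partial_z^Nf\;\partial_{\bar z}^Ng ;$$ below, $f\star g=h$ in $\mathcal A_\hbar$ means that all summands lie in $\mathcal A_\hbar$ and that the series converges to $h$, absolutely and unconditionally in the topology of $\mathcal A_\hbar$. An element $u\in\mathcal A_\hbar$ is unitary if $\bar u\in\mathcal A_\hbar$ and $\bar u\star u=1=u\star\bar u$. Write $\bar w v=\sum_k\bar w_kv_k$. The Heisenberg group is $\mathsf H_n=\mathbb C^n\times\mathbb R$ with $(w,c)\cdot(w',c')=(w+w',\,c+c'+\operatorname{Im}(\bar ww'))$. Its Lie algebra $\mathfrak h_n$ is identified with $\mathsf H_n$ by the exponential map: it is the real vector space $\mathbb C^n\times\mathbb R$ with bracket $[(w,c),(w',c')]=(0,2\operatorname{Im}(\bar ww'))$. Put $$u_{(w,c)}(z)=\exp\Bigl(-\frac{i}{2\hbar}c-\frac{\bar ww}{4\hbar}+\frac{\bar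 wz-w\bar z}{2\hbar}\Bigr),\qquad u_w=u_{(w,0)},$$ $$J_{(w,c)}(z)=-\frac{i}{2\hbar}c+\frac{1}{2\hbar}(\bar wz-w\bar z),\qquad J_w=J_{(w,0)}.$$ **Theorem.** All $u_{(w,c)}$ and $J_{(w,c)}$ belong to $\mathcal A_\hbar$, each $u_{(w,c)}$ is unitary, and $(w,c)\mapsto u_{(w,c)}$ is a group morphism: $u_{(0,0)}=1$ and $u_g\star u_h=u_{gh}$ in $\mathcal A_\hbar$ for all $g,h\in\mathsf H_n$. Moreover: 1. The map $\mathfrak h_n\cong\mathsf H_n\ni(w,c)\mapsto u_{(w,c)}\in\mathcal A_\hbar$ is real-analytic in the topology of $\mathcal A_\hbar$: on a ball of some radius $r>0$ about each point it is the sum of a power series converging in $\mathcal A_\hbar$, whose coefficients satisfy Cauchy estimates of radius $r$ for every continuous seminorm. 2. In the topology of $\mathcal A_\hbar$, $\frac{d}{dt}\big|_{t=0}u_{(tw,tc)}=J_{(w,c)}$. The map $(w,c)\mapsto J_{(w,c)}$ is a morphism of Lie algebras from $\mathfrak h_n$ to $\mathcal A_\hbar$ with the $\star$-commutator: it is $\mathbb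 R$-linear and $J_{[x,y]}=J_x\star J_y-J_y\star J_x$. 3. The curve $t\mapsto u_{(tw,tc)}$ is infinitely differentiable in $\mathcal A_\hbar$, the star powers $J_{(w,c)}^{\star k}$ exist in $\mathcal A_\hbar$, and for all $k\in\mathbb N$ $$\frac{d^k}{dt^k}\Big|_{t=0}u_{(tw,tc)}=J_{(w,c)}^{\star k}=\underbrace{J_{(w,c)}\star\cdots\star J_{(w,c)}}_{k\text{ times}} ;$$ explicitly, for $c=0$, $$\frac{d^k}{dt^k}\Big|_{t=0}u_{(tw,0)}=\sum_{\ell=0}^{\lfloor k/2\rfloor}\frac{k!}{\ell!\,(k-2\ell)!}\Bigl(-\frac{\bar ww}{4\hbar}\Bigr)^{\ell}\Bigl(\frac{\bar wz-w\bar z}{2\hbar}\Bigr)^{k-2\ell}.$$ 4. For all $w\in\mathbb C^n$ and $t\in\mathbb R$ the star exponential $$\operatorname{Exp}(tJ_w)=\sum_{k=0}^\infty\frac{t^k}{k!}\,J_w^{\star k}=u_{tw}$$ converges unconditionally in the topology of $\mathcal A_\hbar$. -/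

import Mathlib

open scoped ENNReal ContDiff Topology ComplexConjugate

noncomputable section

namespace Wick

variable {n : ℕ}

/-! ### Wirtinger derivatives on `ℂⁿ` -/

/-- The holomorphic Wirtinger derivative `∂f/∂zᵏ = (∂f/∂xᵏ - i ∂f/∂yᵏ) / 2`. -/
def dz (k : Fin n) (f : (Fin n → ℂ) → ℂ) : (Fin n → ℂ) → ℂ := fun z =>
  (fderiv ℝ f z (Pi.single k 1) - Complex.I * fderiv ℝ f z (Pi.single k Complex.I)) / 2

/-- The antiholomorphic Wirtinger derivative `∂f/∂z̄ᵏ = (∂f/∂xᵏ + i ∂f/∂yᵏ) / 2`. -/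
def dzbar (k : Fin n) (f : (Fin n → ℂ) → ℂ) : (Fin n → ℂ) → ℂ := fun z =>
  (fderiv ℝ f z (Pi.single k 1) + Complex.I * fderiv ℝ f z (Pi.single k Complex.I)) / 2

/-- The mixed derivative `∂^{|R|+|S|} f / ∂z^R ∂z̄^S` for multiindices `R`, `S`. -/
def wirtinger (R S : Fin n → ℕ) (f : (Fin n → ℂ) → ℂ) : (Fin n → ℂ) → ℂ :=
  (List.finRange n).foldr (fun k g => (dz k)^[R k] ((dzbar k)^[S k] g)) f

/-- `|R| = r₁ + ⋯ + rₙ`. -/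
def mdeg (R : Fin n → ℕ) : ℕ := ∑ k, R k

/-- `R! = r₁! ⋯ rₙ!`. -/
def mfact (R : Fin n → ℕ) : ℕ := ∏ k, (R k).factorial

/-- The binomial coefficient of multiindices. -/
def mchoose (R I : Fin n → ℕ) : ℕ := ∏ k, (R k).choose (I k)

/-! ### The seminorms -/

/-- The quantities `h_{m,ℓ,R,S}(f) ∈ [0,∞]` at the point `p`
(only the values with `ℓ < 2 ^ m` are used). -/
def hSum (hbar : ℝ) (p : Fin n → ℂ) (f : (Fin n → ℂ) → ℂ) :
    ℕ → ℕ → (Fin n → ℕ) → (Fin n → ℕ) → ℝ≥0∞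
  | 0, _, R, S => ∑' N : Fin n → ℕ,
      ENNReal.ofReal ((2 * hbar) ^ (mdeg R + mdeg S + mdeg N) / (mfact N : ℝ)) *
        ‖wirtinger R (N + S) f p‖ₑ ^ 2
  | m + 1, l, R, S => ∑' N : Fin n → ℕ, (mfact N : ℝ≥0∞)⁻¹ *
      (∑ I ∈ Finset.Iic R, ∑ J ∈ Finset.Iic (N + S),
        ((mchoose R I * mchoose (N + S) J : ℕ) : ℝ≥0∞) *
          (if Even l then hSum hbar p f m (l / 2) I J else hSum hbar p f m (l / 2) J I)) ^ 2

/-- `‖f‖_{m,ℓ,R,S}`, the `2^{m+1}`-th root of `h_{m,ℓ,R,S}(f)`. -/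
def hNorm (hbar : ℝ) (p : Fin n → ℂ) (m l : ℕ) (R S : Fin n → ℕ) (f : (Fin n → ℂ) → ℂ) :
    ℝ≥0∞ :=
  (hSum hbar p f m l R S) ^ (1 / (2 ^ (m + 1) : ℝ))

/-! #### Facts needed for the seminorms to be seminorms -/

section Linear

variable {f g : (Fin n → ℂ) → ℂ}

theorem contDiff_fderiv_apply (hf : ContDiff ℝ ∞ f) (v : Fin n → ℂ) :
    ContDiff ℝ ∞ (fun z => fderiv ℝ f z v) :=
  (hf.fderiv_right (m := ∞) (by simp)).clm_apply contDiff_const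

theorem contDiff_dz (k : Fin n) (hf : ContDiff ℝ ∞ f) : ContDiff ℝ ∞ (dz k f) :=
  ((contDiff_fderiv_apply hf _).sub
    (contDiff_const.mul (contDiff_fderiv_apply hf _))).div_const 2

theorem contDiff_dzbar (k : Fin n) (hf : ContDiff ℝ ∞ f) : ContDiff ℝ ∞ (dzbar k f) :=
  ((contDiff_fderiv_apply hf _).add
    (contDiff_const.mul (contDiff_fderiv_apply hf _))).div_const 2

theorem differentiable_of_smooth (hf : ContDiff ℝ ∞ f) : Differentiable ℝ f :=
  hf.differentiable (by simp)

theorem dz_add (k : Fin n) (hf : ContDiff ℝ ∞ f) (hg : ContDiff ℝ ∞ g) :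
    dz k (f + g) = dz k f + dz k g := by
  funext z
  simp only [dz, Pi.add_apply]
  rw [fderiv_add (differentiable_of_smooth hf z) (differentiable_of_smooth hg z)]
  simp only [add_apply]
  ring

theorem dzbar_add (k : Fin n) (hf : ContDiff ℝ ∞ f) (hg : ContDiff ℝ ∞ g) :
    dzbar k (f + g) = dzbar k f + dzbar k g := by
  funext z
  simp only [dzbar, Pi.add_apply]
  rw [fderiv_add (differentiable_of_smooth hf z) (differentiable_of_smooth hg z)]
  simp only [add_apply]
  ring

theorem dz_smul (k : Fin n) (c : ℂ) (hf : ContDiff ℝ ∞ f) : dz k (c • f) = c • dz k f := by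
  funext z
  simp only [dz, Pi.smul_apply]
  rw [fderiv_const_smul (differentiable_of_smooth hf z)]
  simp only [smul_apply, smul_eq_mul]
  ring

theorem dzbar_smul (k : Fin n) (c : ℂ) (hf : ContDiff ℝ ∞ f) :
    dzbar k (c • f) = c • dzbar k f := by
  funext z
  simp only [dzbar, Pi.smul_apply]
  rw [fderiv_const_smul (differentiable_of_smooth hf z)]
  simp only [smul_apply, smul_eq_mul]
  ring

/-- `D` maps smooth functions to smooth functions and is linear on them. -/
def SmoothLinear (D : ((Fin n → ℂ) → ℂ) → (Fin n → ℂ) → ℂ) : Prop :=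
  (∀ f, ContDiff ℝ ∞ f → ContDiff ℝ ∞ (D f)) ∧
  (∀ f g, ContDiff ℝ ∞ f → ContDiff ℝ ∞ g → D (f + g) = D f + D g) ∧
  ∀ (c : ℂ) f, ContDiff ℝ ∞ f → D (c • f) = c • D f

theorem SmoothLinear.comp {D E : ((Fin n → ℂ) → ℂ) → (Fin n → ℂ) → ℂ}
    (hD : SmoothLinear D) (hE : SmoothLinear E) : SmoothLinear (fun f => D (E f)) := by
  refine ⟨fun f hf => hD.1 _ (hE.1 _ hf), fun f g hf hg => ?_, fun c f hf => ?_⟩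
  · simp only [hE.2.1 f g hf hg, hD.2.1 _ _ (hE.1 _ hf) (hE.1 _ hg)]
  · simp only [hE.2.2 c f hf, hD.2.2 c _ (hE.1 _ hf)]

theorem SmoothLinear.iterate {D : ((Fin n → ℂ) → ℂ) → (Fin n → ℂ) → ℂ}
    (hD : SmoothLinear D) (r : ℕ) : SmoothLinear (D^[r]) := by
  induction r with
  | zero => exact ⟨fun f hf => hf, fun f g _ _ => rfl, fun c f _ => rfl⟩
  | succ r ih =>
    rw [Function.iterate_succ]
    exact ih.comp hD

theorem smoothLinear_wirtinger (R S : Fin n → ℕ) : SmoothLinear (wirtinger (n := n) R S) := by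
  have h1 : ∀ k : Fin n, SmoothLinear (dz k) := fun k =>
    ⟨fun f => contDiff_dz k, fun f g => dz_add k, fun c f => dz_smul k c⟩
  have h2 : ∀ k : Fin n, SmoothLinear (dzbar k) := fun k =>
    ⟨fun f => contDiff_dzbar k, fun f g => dzbar_add k, fun c f => dzbar_smul k c⟩
  unfold wirtinger
  induction List.finRange n with
  | nil => exact ⟨fun f hf => hf, fun f g _ _ => rfl, fun c f _ => rfl⟩
  | cons k t ih => exact (((h1 k).iterate (R k)).comp ((h2 k).iterate (S k))).comp ih

end Linear

section Minkowski

/-- Minkowski's inequality for weighted sums in `[0,∞]`. -/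
theorem tsum_minkowski {ι : Type*} (w a b : ι → ℝ≥0∞) {q : ℝ} (hq : 1 ≤ q) :
    (∑' i, w i * (a i + b i) ^ q) ^ (1 / q) ≤
      (∑' i, w i * a i ^ q) ^ (1 / q) + (∑' i, w i * b i ^ q) ^ (1 / q) := by
  have hq0 : 0 < q := lt_of_lt_of_le one_pos hq
  let _ : MeasurableSpace ι := ⊤
  have key := ENNReal.lintegral_Lp_add_le (μ := MeasureTheory.Measure.count)
    (f := fun i => w i ^ (1 / q) * a i) (g := fun i => w i ^ (1 / q) * b i)
    (measurable_from_top).aemeasurable (measurable_from_top).aemeasurable hq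
  have e : ∀ c : ι → ℝ≥0∞, ∑' i, w i * c i ^ q = ∑' i, (w i ^ (1 / q) * c i) ^ q := by
    intro c
    refine tsum_congr fun i => ?_
    rw [ENNReal.mul_rpow_of_nonneg _ _ hq0.le, ← ENNReal.rpow_mul,
      one_div_mul_cancel hq0.ne', ENNReal.rpow_one]
  have mc : MeasurableSingletonClass ι := ⟨fun _ => trivial⟩
  rw [MeasureTheory.lintegral_count, MeasureTheory.lintegral_count,
    MeasureTheory.lintegral_count] at key
  rw [e, e, e]
  simpa only [Pi.add_apply, mul_add] using key

/-- Minkowski's inequality for weighted finite sums, for `q`-th powers of subadditive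
quantities. -/
theorem sum_minkowski {ι : Type*} (s : Finset ι) (w x a b : ι → ℝ≥0∞) {q : ℝ} (hq : 1 ≤ q)
    (hx : ∀ i, x i ^ (1 / q) ≤ a i ^ (1 / q) + b i ^ (1 / q)) :
    (∑ i ∈ s, w i * x i) ^ (1 / q) ≤
      (∑ i ∈ s, w i * a i) ^ (1 / q) + (∑ i ∈ s, w i * b i) ^ (1 / q) := by
  have hq0 : 0 < q := lt_of_lt_of_le one_pos hq
  have r : ∀ y : ℝ≥0∞, (y ^ (1 / q)) ^ q = y := fun y => by
    rw [← ENNReal.rpow_mul, one_div_mul_cancel hq0.ne', ENNReal.rpow_one]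
  have key := tsum_minkowski (fun i : s => w i) (fun i : s => a i ^ (1 / q))
    (fun i : s => b i ^ (1 / q)) hq
  simp only [r] at key
  have e : ∀ c : ι → ℝ≥0∞, ∑' i : s, c i = ∑ i ∈ s, c i := fun c => Finset.tsum_subtype s c
  rw [e (fun i => w i * a i), e (fun i => w i * b i),
    e (fun i => w i * (a i ^ (1 / q) + b i ^ (1 / q)) ^ q)] at key
  refine le_trans ?_ key
  refine ENNReal.rpow_le_rpow (Finset.sum_le_sum fun i _ => ?_) (by positivity)
  gcongr
  calc x i = (x i ^ (1 / q)) ^ q := (r _).symm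
    _ ≤ _ := ENNReal.rpow_le_rpow (hx i) hq0.le

/-- Minkowski's inequality for weighted finite double sums. -/
theorem sum_sum_minkowski {ι κ : Type*} (s : Finset ι) (t : Finset κ)
    (w x a b : ι → κ → ℝ≥0∞) {q : ℝ} (hq : 1 ≤ q)
    (hx : ∀ i j, x i j ^ (1 / q) ≤ a i j ^ (1 / q) + b i j ^ (1 / q)) :
    (∑ i ∈ s, ∑ j ∈ t, w i j * x i j) ^ (1 / q) ≤
      (∑ i ∈ s, ∑ j ∈ t, w i j * a i j) ^ (1 / q) +
        (∑ i ∈ s, ∑ j ∈ t, w i j * b i j) ^ (1 / q) := by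
  have key := sum_minkowski (s ×ˢ t) (fun y => w y.1 y.2) (fun y => x y.1 y.2)
    (fun y => a y.1 y.2) (fun y => b y.1 y.2) hq (fun y => hx y.1 y.2)
  simpa only [Finset.sum_product] using key

/-- Minkowski's inequality for weighted sums of squares of `q`-th powers of subadditive
quantities. -/
theorem tsum_sq_minkowski {ι : Type*} (w x a b : ι → ℝ≥0∞) {q : ℝ} (hq : 1 ≤ q)
    (hx : ∀ i, x i ^ (1 / q) ≤ a i ^ (1 / q) + b i ^ (1 / q)) :
    (∑' i, w i * x i ^ 2) ^ (1 / (q * 2)) ≤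
      (∑' i, w i * a i ^ 2) ^ (1 / (q * 2)) + (∑' i, w i * b i ^ 2) ^ (1 / (q * 2)) := by
  have hq0 : 0 < q := lt_of_lt_of_le one_pos hq
  have e : ∀ y : ℝ≥0∞, (y ^ (1 / q)) ^ (q * 2) = y ^ 2 := fun y => by
    rw [← ENNReal.rpow_mul, ← ENNReal.rpow_two]
    congr 1
    field_simp
  have key := tsum_minkowski w (fun i => a i ^ (1 / q)) (fun i => b i ^ (1 / q))
    (q := q * 2) (by linarith)
  simp only [e] at key
  refine le_trans ?_ key
  refine ENNReal.rpow_le_rpow (ENNReal.tsum_le_tsum fun i => ?_) (by positivity)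
  gcongr
  calc x i ^ 2 = (x i ^ (1 / q)) ^ (q * 2) := (e _).symm
    _ ≤ _ := ENNReal.rpow_le_rpow (hx i) (by positivity)

end Minkowski

section Seminorm

variable (hbar : ℝ) (p : Fin n → ℂ) {f g : (Fin n → ℂ) → ℂ}

theorem hNorm_add_le (hf : ContDiff ℝ ∞ f) (hg : ContDiff ℝ ∞ g) (m l : ℕ)
    (R S : Fin n → ℕ) :
    hNorm hbar p m l R S (f + g) ≤ hNorm hbar p m l R S f + hNorm hbar p m l R S g := by
  induction m generalizing l R S with
  | zero =>
    have key := tsum_minkowski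
      (fun N : Fin n → ℕ =>
        ENNReal.ofReal ((2 * hbar) ^ (mdeg R + mdeg S + mdeg N) / (mfact N : ℝ)))
      (fun N => ‖wirtinger R (N + S) f p‖ₑ) (fun N => ‖wirtinger R (N + S) g p‖ₑ)
      (q := 2) (by norm_num)
    simp only [ENNReal.rpow_two] at key
    simp only [hNorm, hSum, zero_add, pow_one]
    refine le_trans ?_ key
    refine ENNReal.rpow_le_rpow (ENNReal.tsum_le_tsum fun N => ?_) (by norm_num)
    gcongr
    rw [(smoothLinear_wirtinger R (N + S)).2.1 f g hf hg]
    exact enorm_add_le _ _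
  | succ m ih =>
    have hq : (1 : ℝ) ≤ 2 ^ (m + 1) := one_le_pow₀ (by norm_num)
    have e2 : ∀ u : (Fin n → ℂ) → ℂ, hNorm hbar p (m + 1) l R S u =
        (hSum hbar p u (m + 1) l R S) ^ (1 / ((2 ^ (m + 1) : ℝ) * 2)) := fun u => by
      rw [hNorm, pow_succ (2 : ℝ) (m + 1)]
    rw [e2, e2, e2]
    simp only [hSum]
    refine tsum_sq_minkowski _ _ _ _ hq fun N => ?_
    refine sum_sum_minkowski _ _ _ _ _ _ hq fun I J => ?_
    by_cases hl : Even l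
    · simp only [if_pos hl]
      exact ih _ _ _
    · simp only [if_neg hl]
      exact ih _ _ _

theorem hSum_smul (c : ℂ) (hf : ContDiff ℝ ∞ f) (m l : ℕ) (R S : Fin n → ℕ) :
    hSum hbar p (c • f) m l R S = ‖c‖ₑ ^ (2 ^ (m + 1)) * hSum hbar p f m l R S := by
  induction m generalizing l R S with
  | zero =>
    simp only [hSum, zero_add, pow_one]
    rw [← ENNReal.tsum_mul_left]
    refine tsum_congr fun N => ?_
    rw [(smoothLinear_wirtinger R (N + S)).2.2 c f hf]
    simp only [Pi.smul_apply, enorm_smul]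
    ring
  | succ m ih =>
    simp only [hSum, ih]
    rw [← ENNReal.tsum_mul_left]
    refine tsum_congr fun N => ?_
    simp only [← mul_ite]
    have : ∀ (I J : Fin n → ℕ) (x : ℝ≥0∞),
        ((mchoose R I * mchoose (N + S) J : ℕ) : ℝ≥0∞) * (‖c‖ₑ ^ (2 ^ (m + 1)) * x) =
        ‖c‖ₑ ^ (2 ^ (m + 1)) * (((mchoose R I * mchoose (N + S) J : ℕ) : ℝ≥0∞) * x) :=
      fun I J x => by ring
    simp only [this, ← Finset.mul_sum]
    rw [pow_succ 2 (m + 1), pow_mul]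
    ring

theorem hNorm_smul (c : ℂ) (hf : ContDiff ℝ ∞ f) (m l : ℕ) (R S : Fin n → ℕ) :
    hNorm hbar p m l R S (c • f) = ‖c‖ₑ * hNorm hbar p m l R S f := by
  simp only [hNorm, hSum_smul hbar p c hf]
  rw [ENNReal.mul_rpow_of_nonneg _ _ (by positivity)]
  congr 1
  rw [← ENNReal.rpow_natCast, ← ENNReal.rpow_mul]
  push_cast
  rw [mul_one_div_cancel (by positivity), ENNReal.rpow_one]

theorem hNorm_zero (m l : ℕ) (R S : Fin n → ℕ) :
    hNorm hbar p m l R S (0 : (Fin n → ℂ) → ℂ) = 0 := by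
  have := hNorm_smul hbar p (0 : ℂ) (f := 0) contDiff_const m l R S
  simpa using this

end Seminorm

/-! ### The space `𝒜_ħ` -/

/-- The labels `(m, ℓ, R, S)` with `0 ≤ ℓ < 2 ^ m` of the defining seminorms. -/
abbrev Label (n : ℕ) : Type := (Σ m : ℕ, Fin (2 ^ m)) × (Fin n → ℕ) × (Fin n → ℕ)

/-- The real-analytic functions `f` on `ℂⁿ` with `‖f‖_{m,ℓ,R,S} < ∞` for all `m`, `ℓ`, `R`,
`S`, as a complex vector space. -/
def wickSubmodule (hbar : ℝ) (p : Fin n → ℂ) : Submodule ℂ ((Fin n → ℂ) → ℂ) where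
  carrier := {f | AnalyticOnNhd ℝ f Set.univ ∧
    ∀ i : Label n, hNorm hbar p i.1.1 i.1.2 i.2.1 i.2.2 f < ⊤}
  zero_mem' := ⟨analyticOnNhd_const, fun i => by rw [hNorm_zero]; exact ENNReal.zero_lt_top⟩
  add_mem' := fun hf hg => ⟨hf.1.add hg.1, fun i =>
    (hNorm_add_le hbar p hf.1.contDiff hg.1.contDiff _ _ _ _).trans_lt
      (ENNReal.add_lt_top.2 ⟨hf.2 i, hg.2 i⟩)⟩
  smul_mem' := fun c f hf => ⟨fun z hz => analyticAt_const.smul (hf.1 z hz), fun i => by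
    rw [hNorm_smul hbar p c hf.1.contDiff]
    exact ENNReal.mul_lt_top enorm_lt_top (hf.2 i)⟩

/-- The space `𝒜_ħ` built at the base point `p`. It is a type of its own: its topology is the
one of the seminorms below, and not the topology of pointwise convergence. -/
def WickSpace (hbar : ℝ) (p : Fin n → ℂ) : Type := wickSubmodule hbar p

namespace WickSpace

variable {hbar : ℝ} {p : Fin n → ℂ}

instance : AddCommGroup (WickSpace hbar p) := inferInstanceAs (AddCommGroup (wickSubmodule hbar p))

instance : Module ℂ (WickSpace hbar p) := inferInstanceAs (Module ℂ (wickSubmodule hbar p))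

instance : FunLike (WickSpace hbar p) (Fin n → ℂ) ℂ where
  coe f := f.1
  coe_injective := Subtype.val_injective

/-- The seminorm `‖·‖_{m,ℓ,R,S}` on `𝒜_ħ`. -/
def seminorm (hbar : ℝ) (p : Fin n → ℂ) : SeminormFamily ℂ (WickSpace hbar p) (Label n) :=
  fun i => Seminorm.of (fun f : wickSubmodule hbar p => (hNorm hbar p i.1.1 i.1.2 i.2.1 i.2.2 f.1).toReal)
    (fun f g => by
      rw [← ENNReal.toReal_add (f.2.2 i).ne (g.2.2 i).ne]
      exact ENNReal.toReal_mono (ENNReal.add_ne_top.2 ⟨(f.2.2 i).ne, (g.2.2 i).ne⟩)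
        (hNorm_add_le hbar p f.2.1.contDiff g.2.1.contDiff _ _ _ _))
    (fun c f => by
      have := hNorm_smul hbar p c f.2.1.contDiff i.1.1 i.1.2 i.2.1 i.2.2
      change (hNorm hbar p i.1.1 i.1.2 i.2.1 i.2.2 (c • f.1)).toReal = _
      rw [this, ENNReal.toReal_mul, toReal_enorm])

/-- The locally convex topology of `𝒜_ħ`. -/
instance : TopologicalSpace (WickSpace hbar p) := (seminorm hbar p).moduleFilterBasis.topology

theorem withSeminorms : WithSeminorms (seminorm hbar p) := ⟨rfl⟩

instance : IsTopologicalAddGroup (WickSpace hbar p) :=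
  (withSeminorms (hbar := hbar) (p := p)).topologicalAddGroup

instance : ContinuousSMul ℂ (WickSpace hbar p) :=
  (withSeminorms (hbar := hbar) (p := p)).continuousSMul

instance : ContinuousSMul ℝ (WickSpace hbar p) :=
  ⟨(continuous_smul (M := ℂ) (X := WickSpace hbar p)).comp
    ((Complex.continuous_ofReal.comp continuous_fst).prodMk continuous_snd)⟩

end WickSpace

/-! ### The Wick star product -/

/-- The summand `(2ħ)^{|N|} / N! · ∂^{|N|}f/∂z^N · ∂^{|N|}g/∂z̄^N` of the Wick star product. -/
def wickTerm (hbar : ℝ) (f g : (Fin n → ℂ) → ℂ) (N : Fin n → ℕ) : (Fin n → ℂ) → ℂ := fun z =>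
  (2 * hbar : ℂ) ^ mdeg N / (mfact N : ℂ) * wirtinger N 0 f z * wirtinger 0 N g z

section Star

variable {hbar : ℝ} {p : Fin n → ℂ}

/-- `f ⋆ g = h` in `𝒜_ħ`: the summands of the Wick star product lie in `𝒜_ħ`, and their series
converges to `h`, absolutely and unconditionally in the topology of `𝒜_ħ`. -/
def IsStarProduct (f g h : WickSpace hbar p) : Prop :=
  ∃ T : (Fin n → ℕ) → WickSpace hbar p,
    (∀ N, ⇑(T N) = wickTerm hbar f g N) ∧
    (∀ i, Summable fun N => WickSpace.seminorm hbar p i (T N)) ∧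
    HasSum T h

/-- `u` is a unitary element of `𝒜_ħ`: the complex conjugate of `u` lies in `𝒜_ħ`, and
`ū ⋆ u = 1 = u ⋆ ū`. -/
def IsUnitary (u : WickSpace hbar p) : Prop :=
  ∃ v e : WickSpace hbar p, (∀ z, v z = conj (u z)) ∧ (∀ z, e z = 1) ∧
    IsStarProduct v u e ∧ IsStarProduct u v e

/-- `[f, g] = f ⋆ g - g ⋆ f = h` in `𝒜_ħ`. -/
def IsStarCommutator (f g h : WickSpace hbar p) : Prop :=
  ∃ a b : WickSpace hbar p, IsStarProduct f g a ∧ IsStarProduct g f b ∧ h = a - b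

/-- `P k` is the `k`-th star power `f ⋆ ⋯ ⋆ f` of `f`, for all `k`. -/
def IsStarPowers (f : WickSpace hbar p) (P : ℕ → WickSpace hbar p) : Prop :=
  (∀ z, P 0 z = 1) ∧ P 1 = f ∧
    ∀ k, IsStarProduct f (P k) (P (k + 1)) ∧ IsStarProduct (P k) f (P (k + 1))

end Star

/-! ### The Heisenberg group and its Lie algebra -/

/-- The Heisenberg group `H_n = ℂⁿ × ℝ`, identified with its Lie algebra by the exponential map
`(w, c) ↦ (w, c)`: as a Lie algebra it carries the vector space structure of `ℂⁿ × ℝ`. -/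
def Heis (n : ℕ) : Type := (Fin n → ℂ) × ℝ

namespace Heis

instance : NormedAddCommGroup (Heis n) := inferInstanceAs (NormedAddCommGroup ((Fin n → ℂ) × ℝ))

instance : NormedSpace ℝ (Heis n) := inferInstanceAs (NormedSpace ℝ ((Fin n → ℂ) × ℝ))

/-- The element `(w, c)`. -/
def mk (w : Fin n → ℂ) (c : ℝ) : Heis n := (w, c)

/-- `Im (w̄ v)`. -/
def im (w v : Fin n → ℂ) : ℝ := (∑ k, conj (w k) * v k).im

theorem im_add_left (w w' v : Fin n → ℂ) : im (w + w') v = im w v + im w' v := by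
  simp [im, add_mul, Finset.sum_add_distrib]

theorem im_add_right (w v v' : Fin n → ℂ) : im w (v + v') = im w v + im w v' := by
  simp [im, mul_add, Finset.sum_add_distrib]

theorem im_self (w : Fin n → ℂ) : im w w = 0 := by
  simp only [im, Complex.im_sum]
  refine Finset.sum_eq_zero fun k _ => ?_
  simp [Complex.mul_im]
  ring

theorem im_smul_right (t : ℝ) (w v : Fin n → ℂ) : im w (t • v) = t * im w v := by
  simp only [im, Complex.im_sum, Finset.mul_sum]
  refine Finset.sum_congr rfl fun k _ => ?_
  simp [Complex.mul_im]
  ring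

theorem im_zero_left (v : Fin n → ℂ) : im 0 v = 0 := by simp [im]

theorem im_zero_right (v : Fin n → ℂ) : im v 0 = 0 := by simp [im]

theorem im_neg_left (w v : Fin n → ℂ) : im (-w) v = -im w v := by
  simp [im, Finset.sum_neg_distrib]

instance : Mul (Heis n) := ⟨fun g h => (g.1 + h.1, g.2 + h.2 + im g.1 h.1)⟩

instance : One (Heis n) := ⟨(0, 0)⟩

instance : Inv (Heis n) := ⟨fun g => (-g.1, -g.2)⟩

/-- The group law `(w, c) · (w', c') = (w + w', c + c' + Im (w̄ w'))`. -/
instance : Group (Heis n) :=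
  Group.ofLeftAxioms
    (fun a b c => Prod.ext (add_assoc a.1 b.1 c.1) (by
      change a.2 + b.2 + im a.1 b.1 + c.2 + im (a.1 + b.1) c.1 =
        a.2 + (b.2 + c.2 + im b.1 c.1) + im a.1 (b.1 + c.1)
      rw [im_add_left, im_add_right]; ring))
    (fun a => Prod.ext (zero_add a.1) (by
      change 0 + a.2 + im 0 a.1 = a.2
      rw [im_zero_left]; ring))
    (fun a => Prod.ext (neg_add_cancel a.1) (by
      change -a.2 + a.2 + im (-a.1) a.1 = 0
      rw [im_neg_left, im_self]; ring))

/-- The Lie bracket `[(w, c), (w', c')] = (0, 2 Im (w̄ w'))`. -/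
instance : Bracket (Heis n) (Heis n) := ⟨fun x y => (0, 2 * im x.1 y.1)⟩

instance : LieRing (Heis n) where
  add_lie x y z := Prod.ext (zero_add (0 : Fin n → ℂ)).symm (by
    change 2 * im (x.1 + y.1) z.1 = 2 * im x.1 z.1 + 2 * im y.1 z.1
    rw [im_add_left]; ring)
  lie_add x y z := Prod.ext (zero_add (0 : Fin n → ℂ)).symm (by
    change 2 * im x.1 (y.1 + z.1) = 2 * im x.1 y.1 + 2 * im x.1 z.1
    rw [im_add_right]; ring)
  lie_self x := Prod.ext rfl (by
    change 2 * im x.1 x.1 = 0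
    rw [im_self]; ring)
  leibniz_lie x y z := Prod.ext (zero_add (0 : Fin n → ℂ)).symm (by
    change 2 * im x.1 0 = 2 * im 0 z.1 + 2 * im y.1 0
    rw [im_zero_left, im_zero_right, im_zero_right]; ring)

instance : LieAlgebra ℝ (Heis n) where
  lie_smul t x y := Prod.ext (smul_zero t).symm (by
    change 2 * im x.1 (t • y.1) = t * (2 * im x.1 y.1)
    rw [im_smul_right]; ring)

end Heis

/-! ### The unitaries and their generators, as functions -/

/-- For `a = ᾱ` and `b = β`, the function
`e_{ᾱ,β}(z, z̄) = exp (ħ ᾱ β) exp (ᾱ z + β z̄)`. -/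
def expFun (hbar : ℝ) (a b : Fin n → ℂ) : (Fin n → ℂ) → ℂ := fun z =>
  Complex.exp (hbar * ∑ k, a k * b k) *
    Complex.exp (∑ k, a k * z k + ∑ k, b k * conj (z k))

/-- `u_w = e_{w̄/2ħ, -w/2ħ}`. -/
def transFun (hbar : ℝ) (w : Fin n → ℂ) : (Fin n → ℂ) → ℂ :=
  expFun hbar (fun k => conj (w k) / (2 * hbar)) (fun k => -(w k / (2 * hbar)))

/-- `u_{(w,c)} = exp (-(i/2ħ) c) u_w`. -/
def heisFun (hbar : ℝ) (g : Heis n) : (Fin n → ℂ) → ℂ := fun z =>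
  Complex.exp (-(Complex.I / (2 * hbar)) * (g.2 : ℂ)) * transFun hbar g.1 z

/-- `J_w(z, z̄) = (w̄ z - w z̄) / 2ħ`. -/
def linFun (hbar : ℝ) (w : Fin n → ℂ) : (Fin n → ℂ) → ℂ := fun z =>
  1 / (2 * hbar) * (∑ k, conj (w k) * z k - ∑ k, w k * conj (z k))

/-- `J_{(w,c)} = -(i/2ħ) c + J_w`. -/
def genFun (hbar : ℝ) (x : Heis n) : (Fin n → ℂ) → ℂ := fun z =>
  -(Complex.I / (2 * hbar)) * (x.2 : ℂ) + linFun hbar x.1 z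

/-! ### Analytic maps into locally convex spaces -/

section Analytic

variable {E F : Type*} [NormedAddCommGroup E] [NormedSpace ℝ E]
  [AddCommGroup F] [Module ℝ F] [TopologicalSpace F] [IsTopologicalAddGroup F]
  [ContinuousSMul ℝ F]

/-- A map from a real normed space to a real locally convex space is real-analytic at `x` if on a
ball of some radius `r > 0` about `x` it is the sum of a power series whose coefficients satisfy
Cauchy estimates of radius `r` for every continuous seminorm. -/
def IsRealAnalyticAt (f : E → F) (x : E) : Prop :=
  ∃ (P : FormalMultilinearSeries ℝ E F) (r : ℝ), 0 < r ∧
    (∀ q : Seminorm ℝ F, Continuous q →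
      ∃ C : ℝ, ∀ (k : ℕ) (v : Fin k → E), q (P k v) ≤ C * ∏ i, (‖v i‖ / r)) ∧
    ∀ y : E, ‖y‖ < r → HasSum (fun k => P k fun _ => y) (f (x + y))

/-- `D k` is the `k`-th derivative of the curve `γ`, for all `k`. -/
def IsIteratedDerivs (γ : ℝ → F) (D : ℕ → ℝ → F) : Prop :=
  D 0 = γ ∧ ∀ k t, HasDerivAt (D k) (D (k + 1) t) t

end Analytic

end Wick

end

open scoped NNReal

noncomputable section

namespace Wick

variable {n : ℕ}

/-! ### Products of exponential series -/

section PiExp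

/-! All functions in play are built by sums and products from functions of affine forms in `z` and
`z̄`, and their derivatives at `p` of order `d` are at most `C ρ^d`. By induction on `m`, such a
bound makes every `‖f‖_{m,ℓ,R,S}` at most `K C`, with `K` depending only on `n`, `ħ`, `ρ` and the
label (`exists_hSum_le`, `hNorm_le_of_der_le`). Hence exponential type implies membership in `𝒜_ħ`,
and limits in `𝒜_ħ` reduce to scalar estimates at the single point `p`, as long as `ρ` is uniform
(`hasSum_of_der`, `hasDerivAt_of_der`).

With `q(v, w) = -v̄w/4ħ` one has `u_{tx} = exp (t J_x + q t²)` for `q = q(w, w)`, the generating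
function of Hermite polynomials `P_k` in `J_x`. They satisfy `P_{k+1} = J_x P_k + 2q P_k'`, and the
right side is `J_x ⋆ P_k`, since an affine factor kills every star summand with `|N| ≥ 2`. Cauchy
estimates for the entire functions `τ ↦ τ^j exp (τ x + q τ²)` (`norm_gauss_le`) supply the uniform
bounds for the derivatives in `t` and for the star exponential.

For two unitaries the star series is a scalar exponential series times one fixed function. The
resulting factor `exp (2 q(w, w'))` differs from the cross terms `q(w, w') + q(w', w)` in the
exponent of `u_{w+w'}` by the antisymmetric part of `q`, which is the Heisenberg cocycle; the same
antisymmetric part gives the Lie bracket (`quad_sub_quad`).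

For analyticity at `g`, `u_{g+y} = exp (L y + q(y, y)) u_g` with `L` linear in `y`. The homogeneous
parts in `y` are diagonals of explicit multilinear maps `hermiteMul`, whose recursion yields the
Cauchy estimates (`norm_der_hermiteMul_le`). -/

theorem summable_norm_and_hasSum_prod_pow_div_factorial (x : Fin n → ℂ) :
    Summable (fun N : Fin n → ℕ => ‖∏ k, x k ^ N k / ((N k).factorial : ℂ)‖) ∧
    HasSum (fun N : Fin n → ℕ => ∏ k, x k ^ N k / ((N k).factorial : ℂ))
      (Complex.exp (∑ k, x k)) := by
  induction n with
  | zero => exact ⟨Summable.of_finite, by simp⟩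
  | succ n ih =>
    obtain ⟨ih1, ih2⟩ := ih (fun k => x k.succ)
    have h1 : Summable (fun m : ℕ => ‖x 0 ^ m / (m.factorial : ℂ)‖) :=
      NormedSpace.norm_expSeries_div_summable (x 0)
    have h2 : HasSum (fun m : ℕ => x 0 ^ m / (m.factorial : ℂ)) (Complex.exp (x 0)) := by
      rw [Complex.exp_eq_exp_ℂ]
      exact NormedSpace.expSeries_div_hasSum_exp (x 0)
    -- Splitting off coordinate `0` turns the series into a product of two absolutely convergent
    -- ones.
    have e : (fun N : Fin (n + 1) → ℕ => ∏ k, x k ^ N k / ((N k).factorial : ℂ)) ∘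
        (Fin.consEquiv fun _ : Fin (n + 1) => ℕ) =
        fun z : ℕ × (Fin n → ℕ) => x 0 ^ z.1 / (z.1.factorial : ℂ) *
          ∏ k, x k.succ ^ z.2 k / ((z.2 k).factorial : ℂ) := by
      funext z
      simp [Fin.prod_univ_succ, Fin.consEquiv, mul_div_mul_comm]
    have h3 := h1.mul_norm ih1
    have h4 := h2.mul ih2 h3.of_norm
    rw [← Complex.exp_add, ← Fin.sum_univ_succ] at h4
    refine ⟨?_, ?_⟩
    · rw [← (Fin.consEquiv fun _ : Fin (n + 1) => ℕ).summable_iff]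
      exact h3.congr fun z => congrArg norm (congrFun e z).symm
    · rw [← (Fin.consEquiv fun _ : Fin (n + 1) => ℕ).hasSum_iff, e]
      exact h4

theorem pow_mdeg_div_mfact {K : Type*} [Field K] (s : K) (N : Fin n → ℕ) :
    s ^ mdeg N / (mfact N : K) = ∏ k, s ^ N k / ((N k).factorial : K) := by
  rw [mdeg, mfact, Finset.prod_div_distrib, Finset.prod_pow_eq_pow_sum, Nat.cast_prod]

theorem mdeg_add (N S : Fin n → ℕ) : mdeg (N + S) = mdeg N + mdeg S := by
  simp [mdeg, Finset.sum_add_distrib]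

theorem tsum_pow_mdeg_div_mfact_ne_top (s : ℝ≥0) :
    ∑' N : Fin n → ℕ, (mfact N : ℝ≥0∞)⁻¹ * (s : ℝ≥0∞) ^ mdeg N ≠ ⊤ := by
  have h := (summable_norm_and_hasSum_prod_pow_div_factorial (n := n) (fun _ => (s : ℂ))).1
  have h' : Summable (fun N : Fin n → ℕ => (mfact N : ℝ≥0)⁻¹ * s ^ mdeg N) := by
    rw [← NNReal.summable_coe]
    refine h.congr fun N => ?_
    rw [← pow_mdeg_div_mfact]
    simp only [norm_div, norm_pow, Complex.norm_natCast]
    push_cast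
    rw [div_eq_inv_mul]
    congr
    simp
  have := ENNReal.tsum_coe_ne_top_iff_summable.2 h'
  convert this using 3 with N
  have : (mfact N : ℝ≥0) ≠ 0 := by
    simp [mfact, Finset.prod_ne_zero_iff, Nat.factorial_ne_zero]
  rw [ENNReal.coe_mul, ENNReal.coe_inv this]
  simp

/-- The box below `R` is a product of intervals, so the sum factors into one-variable binomial
expansions. In the recursion for `h_{m,ℓ,R,S}` this absorbs the binomial weights: a growth rate `σ`
becomes `1 + σ`. -/
theorem sum_Iic_mchoose_mul_pow (R : Fin n → ℕ) (s : ℝ≥0∞) :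
    ∑ I ∈ Finset.Iic R, (mchoose R I : ℝ≥0∞) * s ^ mdeg I = (1 + s) ^ mdeg R := by
  have e : Finset.Iic R = Fintype.piFinset fun k => Finset.range (R k + 1) := by
    ext I
    simp [Pi.le_def, Fintype.mem_piFinset]
  have h : ∀ k, (1 + s) ^ R k = ∑ i ∈ Finset.range (R k + 1), ((R k).choose i : ℝ≥0∞) * s ^ i := by
    intro k
    rw [add_comm, add_pow]
    exact Finset.sum_congr rfl fun i _ => by rw [one_pow]; ring
  rw [mdeg, ← Finset.prod_pow_eq_pow_sum]
  simp only [h]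
  rw [Finset.prod_univ_sum, e]
  refine Finset.sum_congr rfl fun I _ => ?_
  rw [Finset.prod_mul_distrib, mchoose, mdeg, Finset.prod_pow_eq_pow_sum, Nat.cast_prod]

end PiExp

/-! ### Bounding the seminorms by the size of the Taylor coefficients -/

section Bound

/-- If the Taylor coefficients at `p` grow at most exponentially with the order, then all
`h_{m,ℓ,R,S}` are finite, with explicit dependence on the constant. -/
theorem exists_hSum_le (n : ℕ) (hbar : ℝ) (ρ : ℝ≥0) (m : ℕ) :
    ∃ K σ : ℝ≥0, ∀ (p : Fin n → ℂ) (f : (Fin n → ℂ) → ℂ) (C : ℝ≥0),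
      (∀ R S, ‖wirtinger R S f p‖ₑ ≤ C * (ρ : ℝ≥0∞) ^ (mdeg R + mdeg S)) →
      ∀ l R S, hSum hbar p f m l R S ≤
        (C : ℝ≥0∞) ^ (2 ^ (m + 1)) * (K * (σ : ℝ≥0∞) ^ (mdeg R + mdeg S)) := by
  induction m with
  | zero =>
    -- Each order contributes one factor `2ħ` and, through the square, `ρ²`. The absolute value is
    -- there because no sign of `ħ` is assumed.
    set σ : ℝ≥0 := (|2 * hbar|).toNNReal * ρ ^ 2 with hσ
    refine ⟨(∑' N : Fin n → ℕ, (mfact N : ℝ≥0∞)⁻¹ * (σ : ℝ≥0∞) ^ mdeg N).toNNReal, σ,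
      fun p f C h l R S => ?_⟩
    rw [ENNReal.coe_toNNReal (tsum_pow_mdeg_div_mfact_ne_top σ)]
    simp only [hSum]
    rw [mul_comm (∑' N : Fin n → ℕ, _), ← ENNReal.tsum_mul_left, ← ENNReal.tsum_mul_left]
    refine ENNReal.tsum_le_tsum fun N => ?_
    have h1 : ENNReal.ofReal ((2 * hbar) ^ (mdeg R + mdeg S + mdeg N) / (mfact N : ℝ)) ≤
        (mfact N : ℝ≥0∞)⁻¹ *
          (((|2 * hbar|).toNNReal : ℝ≥0) : ℝ≥0∞) ^ (mdeg R + mdeg S + mdeg N) := by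
      have hN : (0 : ℝ) < mfact N := by
        have : 0 < mfact N := Finset.prod_pos fun k _ => Nat.factorial_pos _
        exact_mod_cast this
      rw [ENNReal.ofReal_div_of_pos hN, ENNReal.ofReal_natCast, div_eq_mul_inv, mul_comm]
      gcongr
      rw [← ENNReal.ofReal, ← ENNReal.ofReal_pow (abs_nonneg _), ← abs_pow]
      exact ENNReal.ofReal_le_ofReal (le_abs_self _)
    calc _ ≤ ((mfact N : ℝ≥0∞)⁻¹ *
          (((|2 * hbar|).toNNReal : ℝ≥0) : ℝ≥0∞) ^ (mdeg R + mdeg S + mdeg N)) *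
          (C * (ρ : ℝ≥0∞) ^ (mdeg R + mdeg (N + S))) ^ 2 := by
          gcongr
          exact h _ _
      _ = _ := by
          rw [hσ, mdeg_add]
          push_cast
          ring
  | succ m ih =>
    obtain ⟨K, σ, ih⟩ := ih
    -- The binomial sums give `1 + σ` per order, and the outer square doubles the exponent.
    set τ : ℝ≥0 := (1 + σ) ^ 2 with hτ
    refine ⟨K ^ 2 * (∑' N : Fin n → ℕ, (mfact N : ℝ≥0∞)⁻¹ * (τ : ℝ≥0∞) ^ mdeg N).toNNReal, τ,
      fun p f C h l R S => ?_⟩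
    rw [ENNReal.coe_mul, ENNReal.coe_toNNReal (tsum_pow_mdeg_div_mfact_ne_top τ), mul_assoc,
      ← mul_assoc, mul_comm (∑' N : Fin n → ℕ, _), ← ENNReal.tsum_mul_left,
      ← ENNReal.tsum_mul_left]
    simp only [hSum]
    refine ENNReal.tsum_le_tsum fun N => ?_
    have h1 : ∑ I ∈ Finset.Iic R, ∑ J ∈ Finset.Iic (N + S),
        ((mchoose R I * mchoose (N + S) J : ℕ) : ℝ≥0∞) *
          (if Even l then hSum hbar p f m (l / 2) I J else hSum hbar p f m (l / 2) J I) ≤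
        (C : ℝ≥0∞) ^ (2 ^ (m + 1)) * K * (1 + (σ : ℝ≥0∞)) ^ (mdeg R + mdeg (N + S)) := by
      rw [pow_add (1 + (σ : ℝ≥0∞)), ← sum_Iic_mchoose_mul_pow R, ← sum_Iic_mchoose_mul_pow (N + S),
        Finset.sum_mul_sum, Finset.mul_sum]
      refine Finset.sum_le_sum fun I _ => ?_
      rw [Finset.mul_sum]
      refine Finset.sum_le_sum fun J _ => ?_
      have : (if Even l then hSum hbar p f m (l / 2) I J else hSum hbar p f m (l / 2) J I) ≤
          (C : ℝ≥0∞) ^ (2 ^ (m + 1)) * (K * (σ : ℝ≥0∞) ^ (mdeg I + mdeg J)) := by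
        -- The bound depends on `I` and `J` only through `|I| + |J|`, so the swap for odd `ℓ` is
        -- harmless.
        split_ifs
        · exact ih p f C h _ _ _
        · rw [add_comm (mdeg I)]
          exact ih p f C h _ _ _
      calc _ ≤ ((mchoose R I * mchoose (N + S) J : ℕ) : ℝ≥0∞) *
            ((C : ℝ≥0∞) ^ (2 ^ (m + 1)) * (K * (σ : ℝ≥0∞) ^ (mdeg I + mdeg J))) := by gcongr
        _ = _ := by push_cast; ring
    calc _ ≤ (mfact N : ℝ≥0∞)⁻¹ * ((C : ℝ≥0∞) ^ (2 ^ (m + 1)) * K *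
          (1 + (σ : ℝ≥0∞)) ^ (mdeg R + mdeg (N + S))) ^ 2 := by gcongr
      _ = _ := by
        rw [hτ, mdeg_add, pow_succ 2 (m + 1), pow_mul]
        push_cast
        generalize 1 + (σ : ℝ≥0∞) = s
        ring

end Bound

/-! ### Words of Wirtinger derivatives -/

/-- The Wirtinger derivative in the direction `zᵏ` for `inl k` and `z̄ᵏ` for `inr k`. -/
def dir : Fin n ⊕ Fin n → ((Fin n → ℂ) → ℂ) → (Fin n → ℂ) → ℂ
  | .inl k => dz k
  | .inr k => dzbar k

/-- The iterated Wirtinger derivative along a word of directions. -/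
def der : List (Fin n ⊕ Fin n) → ((Fin n → ℂ) → ℂ) → (Fin n → ℂ) → ℂ
  | [], f => f
  | x :: w, f => der w (dir x f)

/-- The word of directions of `∂^{|R|+|S|} / ∂z^R ∂z̄^S`. -/
def word (R S : Fin n → ℕ) : List (Fin n) → List (Fin n ⊕ Fin n)
  | [] => []
  | k :: t => word R S t ++ List.replicate (S k) (.inr k) ++ List.replicate (R k) (.inl k)

theorem der_append (u v : List (Fin n ⊕ Fin n)) (f : (Fin n → ℂ) → ℂ) :
    der (u ++ v) f = der v (der u f) := by
  induction u generalizing f with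
  | nil => rfl
  | cons x u ih => exact ih _

theorem der_replicate (x : Fin n ⊕ Fin n) (r : ℕ) (f : (Fin n → ℂ) → ℂ) :
    der (List.replicate r x) f = (dir x)^[r] f := by
  induction r generalizing f with
  | zero => rfl
  | succ r ih => exact ih _

/-- Words allow Leibniz arguments one letter at a time, without multiindex binomials and without
commuting derivatives. -/
theorem wirtinger_eq_der (R S : Fin n → ℕ) (f : (Fin n → ℂ) → ℂ) :
    wirtinger R S f = der (word R S (List.finRange n)) f := by
  unfold wirtinger
  induction List.finRange n with
  | nil => rfl
  | cons k t ih =>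
    rw [List.foldr_cons, ih, word, der_append, der_append, der_replicate, der_replicate]
    rfl

theorem prod_map_word (R S : Fin n → ℕ) {M : Type*} [CommMonoid M] (c : Fin n ⊕ Fin n → M) :
    ((word R S (List.finRange n)).map c).prod =
      (∏ k, c (.inl k) ^ R k) * ∏ k, c (.inr k) ^ S k := by
  rw [← Finset.prod_mul_distrib, Fin.prod_univ_def]
  induction List.finRange n with
  | nil => rfl
  | cons k t ih =>
    simp only [word, List.map_append, List.prod_append, ih, List.map_replicate,
      List.prod_replicate, List.map_cons, List.prod_cons]
    rw [mul_assoc, mul_comm, mul_comm (c (.inr k) ^ _)]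

theorem length_word (R S : Fin n → ℕ) :
    (word R S (List.finRange n)).length = mdeg R + mdeg S := by
  rw [mdeg, mdeg, ← Finset.sum_add_distrib, Fin.sum_univ_def]
  induction List.finRange n with
  | nil => rfl
  | cons k t ih =>
    simp only [word, List.length_append, ih, List.length_replicate, List.map_cons, List.sum_cons]
    ring

theorem smoothLinear_dir (x : Fin n ⊕ Fin n) : SmoothLinear (dir x) := by
  cases x with
  | inl k => exact ⟨fun f => contDiff_dz k, fun f g => dz_add k, fun c f => dz_smul k c⟩
  | inr k => exact ⟨fun f => contDiff_dzbar k, fun f g => dzbar_add k, fun c f => dzbar_smul k c⟩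

theorem smoothLinear_der (w : List (Fin n ⊕ Fin n)) : SmoothLinear (der w) := by
  induction w with
  | nil => exact ⟨fun f hf => hf, fun f g _ _ => rfl, fun c f _ => rfl⟩
  | cons x w ih => exact ih.comp (smoothLinear_dir x)

theorem dir_mul (x : Fin n ⊕ Fin n) {f g : (Fin n → ℂ) → ℂ} (hf : ContDiff ℝ ∞ f)
    (hg : ContDiff ℝ ∞ g) : dir x (f * g) = dir x f * g + f * dir x g := by
  funext z
  cases x <;>
  · simp only [dir, dz, dzbar, Pi.add_apply, Pi.mul_apply]
    rw [fderiv_mul (differentiable_of_smooth hf z) (differentiable_of_smooth hg z)]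
    simp only [add_apply, smul_apply, smul_eq_mul]
    ring

/-- The head of a word acts first, so the Leibniz rule splits off one letter and leaves two products
under a shorter word. Inductions along words therefore have to vary both factors. -/
theorem der_cons_mul (x : Fin n ⊕ Fin n) (w : List (Fin n ⊕ Fin n)) {f g : (Fin n → ℂ) → ℂ}
    (hf : ContDiff ℝ ∞ f) (hg : ContDiff ℝ ∞ g) :
    der (x :: w) (f * g) = der w (dir x f * g) + der w (f * dir x g) := by
  have hf' := (smoothLinear_dir x).1 f hf
  have hg' := (smoothLinear_dir x).1 g hg
  rw [der, dir_mul x hf hg]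
  exact (smoothLinear_der w).2.1 _ _ (hf'.mul hg) (hf.mul hg')

/-- Differentiating one factor replaces `C` by `C ρ` or `D` by `D σ`; adding the two Leibniz
branches produces the rate `ρ + σ`. -/
theorem norm_der_mul_le {p : Fin n → ℂ} {f g : (Fin n → ℂ) → ℂ} {C D ρ σ : ℝ}
    (hf : ContDiff ℝ ∞ f) (hg : ContDiff ℝ ∞ g)
    (hC : ∀ w, ‖der w f p‖ ≤ C * ρ ^ w.length) (hD : ∀ w, ‖der w g p‖ ≤ D * σ ^ w.length)
    (w : List (Fin n ⊕ Fin n)) : ‖der w (f * g) p‖ ≤ C * D * (ρ + σ) ^ w.length := by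
  induction w generalizing f g C D with
  | nil =>
    have h1 := hC []
    have h2 := hD []
    simp only [der, List.length_nil, pow_zero, mul_one, Pi.mul_apply, norm_mul] at *
    exact mul_le_mul h1 h2 (norm_nonneg _) ((norm_nonneg _).trans h1)
  | cons x w ih =>
    rw [der_cons_mul x w hf hg, Pi.add_apply]
    have h1 := ih (C := C * ρ) ((smoothLinear_dir x).1 f hf) hg
      (fun w => (hC (x :: w)).trans_eq (by rw [List.length_cons]; ring)) hD
    have h2 := ih (D := D * σ) hf ((smoothLinear_dir x).1 g hg) hC
      (fun w => (hD (x :: w)).trans_eq (by rw [List.length_cons]; ring))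
    refine (norm_add_le _ _).trans ((add_le_add h1 h2).trans_eq ?_)
    rw [List.length_cons]
    ring

theorem hasSum_der_mul {ι : Type*} {p : Fin n → ℂ} {f : ι → (Fin n → ℂ) → ℂ}
    {s g : (Fin n → ℂ) → ℂ} (hf : ∀ i, ContDiff ℝ ∞ (f i)) (hs : ContDiff ℝ ∞ s)
    (hg : ContDiff ℝ ∞ g) (h : ∀ w, HasSum (fun i => der w (f i) p) (der w s p))
    (w : List (Fin n ⊕ Fin n)) :
    HasSum (fun i => der w (f i * g) p) (der w (s * g) p) := by
  induction w generalizing f s g with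
  | nil => exact (h []).mul_right (g p)
  | cons x w ih =>
    simp only [der_cons_mul x w (hf _) hg, der_cons_mul x w hs hg, Pi.add_apply]
    exact (ih (fun i => (smoothLinear_dir x).1 _ (hf i)) ((smoothLinear_dir x).1 _ hs) hg
      fun w => h (x :: w)).add (ih hf hs ((smoothLinear_dir x).1 _ hg) h)

/-! ### Functions of exponential type in `𝒜_ħ` -/

section ExpType

variable {hbar : ℝ} {p : Fin n → ℂ} {f g : (Fin n → ℂ) → ℂ}

/-- `f` is real-analytic, and its Wirtinger derivatives at `p` grow at most exponentially with the
order. -/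
def IsExpType (p : Fin n → ℂ) (f : (Fin n → ℂ) → ℂ) : Prop :=
  AnalyticOnNhd ℝ f Set.univ ∧
    ∃ C ρ : ℝ, 0 ≤ ρ ∧ ∀ w, ‖der w f p‖ ≤ C * ρ ^ w.length

theorem IsExpType.contDiff (hf : IsExpType p f) : ContDiff ℝ ∞ f := hf.1.contDiff

theorem IsExpType.mul (hf : IsExpType p f) (hg : IsExpType p g) : IsExpType p (f * g) := by
  obtain ⟨hf1, C, ρ, hρ, hC⟩ := hf
  obtain ⟨hg1, D, σ, hσ, hD⟩ := hg
  exact ⟨hf1.mul hg1, C * D, ρ + σ, by positivity,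
    norm_der_mul_le hf1.contDiff hg1.contDiff hC hD⟩

theorem IsExpType.smul (c : ℂ) (hf : IsExpType p f) : IsExpType p (c • f) := by
  obtain ⟨hf1, C, ρ, hρ, hC⟩ := hf
  refine ⟨fun z hz => analyticAt_const.smul (hf1 z hz), ‖c‖ * C, ρ, hρ, fun w => ?_⟩
  rw [(smoothLinear_der w).2.2 c f hf1.contDiff, Pi.smul_apply, norm_smul, mul_assoc]
  gcongr
  exact hC w

/-- The bound on `h_{m,ℓ,R,S}` is homogeneous of degree `2^{m+1}` in `C`, so its root is linear in
`C`. It matters that `K` is chosen before `f` and `C`: the same `K` then serves all remainders of a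
series or a difference quotient. -/
theorem hNorm_le_of_der_le (hbar : ℝ) (i : Label n) (ρ : ℝ≥0) :
    ∃ K : ℝ≥0, ∀ (p : Fin n → ℂ) (f : (Fin n → ℂ) → ℂ) (C : ℝ≥0),
      (∀ w, ‖der w f p‖ ≤ C * ρ ^ w.length) →
      hNorm hbar p i.1.1 i.1.2 i.2.1 i.2.2 f ≤ (K * C : ℝ≥0) := by
  obtain ⟨K, σ, h⟩ := exists_hSum_le n hbar ρ i.1.1
  refine ⟨(K * σ ^ (mdeg i.2.1 + mdeg i.2.2)) ^ (1 / (2 ^ (i.1.1 + 1) : ℝ)),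
    fun p f C hC => ?_⟩
  have hC' : ∀ R S, ‖wirtinger R S f p‖ₑ ≤ C * (ρ : ℝ≥0∞) ^ (mdeg R + mdeg S) := fun R S => by
    rw [wirtinger_eq_der, ← length_word, ← ENNReal.coe_pow, ← ENNReal.coe_mul]
    exact enorm_le_coe.2 (mod_cast hC _)
  refine (ENNReal.rpow_le_rpow (h p f C hC' i.1.2 i.2.1 i.2.2) (by positivity)).trans_eq ?_
  rw [ENNReal.mul_rpow_of_nonneg _ _ (by positivity), ← ENNReal.rpow_natCast, ← ENNReal.rpow_mul]
  push_cast
  rw [mul_one_div_cancel (by positivity), ENNReal.rpow_one, mul_comm,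
    ENNReal.coe_rpow_of_nonneg _ (by positivity)]
  push_cast
  rfl

theorem IsExpType.mem (hbar : ℝ) (hf : IsExpType p f) : f ∈ wickSubmodule hbar p := by
  obtain ⟨hf1, C, ρ, hρ, hC⟩ := hf
  refine ⟨hf1, fun i => ?_⟩
  obtain ⟨K, h⟩ := hNorm_le_of_der_le hbar i ⟨ρ, hρ⟩
  have hC0 : 0 ≤ C := by simpa [der] using (norm_nonneg _).trans (hC [])
  exact (h p f ⟨C, hC0⟩ hC).trans_lt ENNReal.coe_lt_top

end ExpType

/-! ### Convergence and differentiability in `𝒜_ħ` tested on derivatives at `p`. -/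

namespace WickSpace

variable {hbar : ℝ} {p : Fin n → ℂ}

/-- The element of `𝒜_ħ` given by a function of exponential type. -/
def ofExpType (hbar : ℝ) {p : Fin n → ℂ} (f : (Fin n → ℂ) → ℂ) (hf : IsExpType p f) :
    WickSpace hbar p := ⟨f, hf.mem hbar⟩

@[simp] theorem coe_ofExpType (f : (Fin n → ℂ) → ℂ) (hf : IsExpType p f) :
    ⇑(ofExpType hbar f hf) = f := rfl

/-- The inclusion of `𝒜_ħ` into the space of all functions. -/
def toFunₗ : WickSpace hbar p →ₗ[ℂ] (Fin n → ℂ) → ℂ := (wickSubmodule hbar p).subtype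

theorem coe_add (f g : WickSpace hbar p) : ⇑(f + g) = ⇑f + ⇑g := rfl

theorem coe_sub (f g : WickSpace hbar p) : ⇑(f - g) = ⇑f - ⇑g := rfl

theorem coe_smul (c : ℂ) (f : WickSpace hbar p) : ⇑(c • f) = c • ⇑f := rfl

theorem coe_real_smul (c : ℝ) (f : WickSpace hbar p) : ⇑(c • f) = (c : ℂ) • ⇑f := rfl

theorem coe_sum {ι : Type*} (s : Finset ι) (f : ι → WickSpace hbar p) :
    ⇑(∑ i ∈ s, f i) = ∑ i ∈ s, ⇑(f i) := map_sum toFunₗ f s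

theorem contDiff (f : WickSpace hbar p) : ContDiff ℝ ∞ f := f.2.1.contDiff

theorem real_smul_eq (c : ℝ) (f : WickSpace hbar p) : c • f = (c : ℂ) • f := rfl

/-- The iterated derivative at `p` along the word `w`, as a linear functional. -/
def derₗ (w : List (Fin n ⊕ Fin n)) : WickSpace hbar p →ₗ[ℂ] ℂ where
  toFun f := der w f p
  map_add' f g := congrFun ((smoothLinear_der w).2.1 f g f.contDiff g.contDiff) p
  map_smul' c f := congrFun ((smoothLinear_der w).2.2 c f f.contDiff) p

theorem derₗ_apply (w : List (Fin n ⊕ Fin n)) (f : WickSpace hbar p) : derₗ w f = der w f p := rfl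

theorem exists_seminorm_le (i : Label n) {ρ : ℝ} (hρ : 0 ≤ ρ) :
    ∃ K : ℝ, 0 ≤ K ∧ ∀ (f : WickSpace hbar p) (C : ℝ),
      (∀ w, ‖derₗ w f‖ ≤ C * ρ ^ w.length) → seminorm hbar p i f ≤ K * C := by
  obtain ⟨K, h⟩ := hNorm_le_of_der_le hbar i ⟨ρ, hρ⟩
  refine ⟨K, K.2, fun f C hC => ?_⟩
  have hC0 : 0 ≤ C := by simpa using (norm_nonneg _).trans (hC [])
  exact ENNReal.toReal_le_coe_of_le_coe (h p f ⟨C, hC0⟩ hC)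

/-- A Weierstrass test: termwise convergence of all derivatives at `p`, together with a summable
majorant and a common rate `ρ`, bounds the remainder's derivatives by the tail of `c` times `ρ^d`,
and hence each seminorm of the remainder by a multiple of that tail. -/
theorem hasSum_of_der {ι : Type*} {T : ι → WickSpace hbar p} {s : WickSpace hbar p} {c : ι → ℝ}
    {ρ : ℝ} (hρ : 0 ≤ ρ) (hc : Summable c)
    (hb : ∀ i w, ‖der w (T i) p‖ ≤ c i * ρ ^ w.length)
    (h : ∀ w, HasSum (fun i => der w (T i) p) (der w s p)) : HasSum T s := by
  refine (withSeminorms.tendsto_nhds _ _).2 fun i ε hε => ?_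
  obtain ⟨K, hK, hKb⟩ := exists_seminorm_le (hbar := hbar) (p := p) i hρ
  have key : ∀ S : Finset ι, seminorm hbar p i (∑ j ∈ S, T j - s) ≤
      K * (∑' j, c j - ∑ j ∈ S, c j) := by
    intro S
    refine hKb _ _ fun w => ?_
    rw [map_sub, map_sum, norm_sub_rev]
    have h1 : HasSum (fun j : {x // x ∉ S} => der w (T j) p)
        (der w s p - ∑ j ∈ S, der w (T j) p) := by
      rw [S.hasSum_compl_iff (f := fun j => der w (T j) p), sub_add_cancel]
      exact h w
    have h2 : HasSum (fun j : {x // x ∉ S} => c j) (∑' j, c j - ∑ j ∈ S, c j) := by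
      rw [S.hasSum_compl_iff, sub_add_cancel]
      exact hc.hasSum
    exact h1.norm_le_of_bounded (h2.mul_right (ρ ^ w.length)) fun j => hb j w
  have hlim : Filter.Tendsto (fun S : Finset ι => K * (∑' j, c j - ∑ j ∈ S, c j))
      Filter.atTop (𝓝 0) := by
    have h3 : Filter.Tendsto (fun S : Finset ι => ∑ j ∈ S, c j) Filter.atTop (𝓝 (∑' j, c j)) :=
      hc.hasSum
    simpa using ((tendsto_const_nhds (x := ∑' j, c j)).sub h3).const_mul K
  rw [SummationFilter.unconditional_filter]
  filter_upwards [hlim.eventually_lt_const hε] with S hS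
  exact (key S).trans_lt hS

/-- A quadratic Taylor remainder with a common rate `ρ` makes each seminorm of the difference
quotient minus `γ'` at most `K C |x - t|`. -/
theorem hasDerivAt_of_der {γ : ℝ → WickSpace hbar p} {γ' : WickSpace hbar p} {t C ρ : ℝ}
    (hρ : 0 ≤ ρ)
    (h : ∀ x, |x - t| ≤ 1 → ∀ w, ‖derₗ w (γ x) - derₗ w (γ t) - (x - t : ℝ) * derₗ w γ'‖ ≤
      C * |x - t| ^ 2 * ρ ^ w.length) : HasDerivAt γ γ' t := by
  -- In a topological vector space the little-o condition becomes convergence to zero of the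
  -- remainder scaled by `(x - t)⁻¹`; the remainder vanishes at `x = t`.
  rw [hasDerivAt_iff_hasFDerivAt, HasFDerivAt, hasFDerivAtFilter_iff_isLittleOTVS,
    Asymptotics.isLittleOTVS_iff_tendsto_inv_smul (by
      rw [Filter.prod_pure, Filter.eventually_map]
      refine Filter.Eventually.of_forall fun x hx => ?_
      simp only [sub_eq_zero] at hx
      simp [hx]), Filter.prod_pure, Filter.tendsto_map'_iff]
  refine (withSeminorms.tendsto_nhds _ _).2 fun i ε hε => ?_
  obtain ⟨K, hK, hKb⟩ := exists_seminorm_le (hbar := hbar) (p := p) i hρ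
  have hlim : Filter.Tendsto (fun x : ℝ => K * (C * |x - t|)) (𝓝 t) (𝓝 0) := by
    have : Continuous fun x : ℝ => K * (C * |x - t|) := by fun_prop
    simpa using this.tendsto t
  filter_upwards [hlim.eventually_lt_const hε, Metric.closedBall_mem_nhds t one_pos] with x hx hx1
  rw [Metric.mem_closedBall, Real.dist_eq] at hx1
  refine (hKb _ _ fun w => ?_).trans_lt hx
  simp only [Function.comp_apply, ContinuousLinearMap.toSpanSingleton_apply, sub_zero,
    real_smul_eq]
  rw [map_smul, map_sub (derₗ w), map_sub (derₗ w), map_smul, smul_eq_mul, smul_eq_mul, norm_mul]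
  have h1 := h x hx1 w
  rcases eq_or_ne x t with rfl | hxt
  · simp
  have hpos : 0 < |x - t| := abs_pos.2 (sub_ne_zero.2 hxt)
  rw [Complex.norm_real, norm_inv, Real.norm_eq_abs, inv_mul_le_iff₀ hpos]
  refine h1.trans_eq ?_
  ring

end WickSpace

/-! ### Functions of an affine form in `z` and `z̄` -/

section Affine

/-- The real-linear form `∑ aₖ zᵏ + ∑ bₖ z̄ᵏ` with `a = c ∘ inl` and `b = c ∘ inr`. -/
def linForm (c : Fin n ⊕ Fin n → ℂ) : (Fin n → ℂ) →L[ℝ] ℂ :=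
  ∑ k, c (.inl k) • (ContinuousLinearMap.proj k : (Fin n → ℂ) →L[ℝ] ℂ) +
    ∑ k, c (.inr k) • (Complex.conjCLE : ℂ →L[ℝ] ℂ).comp
      (ContinuousLinearMap.proj k : (Fin n → ℂ) →L[ℝ] ℂ)

theorem linForm_apply (c : Fin n ⊕ Fin n → ℂ) (z : Fin n → ℂ) :
    linForm c z = ∑ k, c (.inl k) * z k + ∑ k, c (.inr k) * conj (z k) := by
  simp [linForm, sum_apply]

theorem linForm_single (c : Fin n ⊕ Fin n → ℂ) (k : Fin n) (x : ℂ) :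
    linForm c (Pi.single k x) = c (.inl k) * x + c (.inr k) * conj x := by
  rw [linForm_apply, Finset.sum_eq_single k, Finset.sum_eq_single k]
  · simp
  all_goals simp +contextual

/-- The affine form `b + ∑ aₖ zᵏ + ∑ bₖ z̄ᵏ`. -/
def aff (c : Fin n ⊕ Fin n → ℂ) (b : ℂ) (z : Fin n → ℂ) : ℂ := b + linForm c z

theorem hasFDerivAt_aff (c : Fin n ⊕ Fin n → ℂ) (b : ℂ) (z : Fin n → ℂ) :
    HasFDerivAt (aff c b) (linForm c) z := (linForm c).hasFDerivAt.const_add b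

/-- Because `φ` is holomorphic, the chain rule needs only `φ'`, and the Wirtinger combination of `1`
and `i` picks out one coefficient of the form. -/
theorem dir_comp_aff (c : Fin n ⊕ Fin n → ℂ) (b : ℂ) {φ φ' : ℂ → ℂ}
    (h : ∀ x, HasDerivAt φ (φ' x) x) (x : Fin n ⊕ Fin n) :
    dir x (fun z => φ (aff c b z)) = fun z => c x * φ' (aff c b z) := by
  have h1 : ∀ z v, fderiv ℝ (fun z => φ (aff c b z)) z v = φ' (aff c b z) * linForm c v := by
    intro z v
    have := ((h (aff c b z)).hasFDerivAt.restrictScalars ℝ).comp z (hasFDerivAt_aff c b z)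
    change fderiv ℝ (φ ∘ aff c b) z v = _
    rw [this.fderiv]
    simp [mul_comm]
  funext z
  cases x with
  | inl k =>
    simp only [dir, dz, h1, linForm_single, map_one, Complex.conj_I]
    linear_combination (-(c (.inl k)) + c (.inr k)) / 2 * φ' (aff c b z) * Complex.I_sq
  | inr k =>
    simp only [dir, dzbar, h1, linForm_single, map_one, Complex.conj_I]
    linear_combination (c (.inl k) - c (.inr k)) / 2 * φ' (aff c b z) * Complex.I_sq

theorem analyticOnNhd_comp_aff (c : Fin n ⊕ Fin n → ℂ) (b : ℂ) {φ : ℂ → ℂ}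
    (h : Differentiable ℂ φ) : AnalyticOnNhd ℝ (fun z => φ (aff c b z)) Set.univ := by
  intro z _
  have h1 : AnalyticAt ℝ (aff c b) z := analyticAt_const.add ((linForm c).analyticAt z)
  exact ((h.analyticAt _).restrictScalars (𝕜 := ℝ)).comp h1

theorem der_comp_aff (c : Fin n ⊕ Fin n → ℂ) (b : ℂ) {φ : ℕ → ℂ → ℂ}
    (h : ∀ j x, HasDerivAt (φ j) (φ (j + 1) x) x) (w : List (Fin n ⊕ Fin n)) (j : ℕ) :
    der w (fun z => φ j (aff c b z)) =
      fun z => (w.map c).prod * φ (j + w.length) (aff c b z) := by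
  induction w generalizing j with
  | nil => simp [der]
  | cons x w ih =>
    rw [der, dir_comp_aff c b (h j)]
    have := (smoothLinear_der w).2.2 (c x) (fun z => φ (j + 1) (aff c b z))
      (analyticOnNhd_comp_aff c b fun y => (h (j + 1) y).differentiableAt).contDiff
    change der w (c x • fun z => φ (j + 1) (aff c b z)) = _
    rw [this, ih]
    funext z
    simp only [Pi.smul_apply, smul_eq_mul, List.map_cons, List.prod_cons, List.length_cons]
    rw [mul_assoc, add_right_comm, add_assoc]

theorem wirtinger_comp_aff (c : Fin n ⊕ Fin n → ℂ) (b : ℂ) {φ : ℕ → ℂ → ℂ}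
    (h : ∀ j x, HasDerivAt (φ j) (φ (j + 1) x) x) (R S : Fin n → ℕ) (z : Fin n → ℂ) :
    wirtinger R S (fun z => φ 0 (aff c b z)) z =
      (∏ k, c (.inl k) ^ R k) * (∏ k, c (.inr k) ^ S k) *
        φ (mdeg R + mdeg S) (aff c b z) := by
  rw [wirtinger_eq_der, der_comp_aff c b h, prod_map_word, length_word, zero_add]

theorem norm_prod_map_le {c : Fin n ⊕ Fin n → ℂ} {ρ : ℝ} (hρ : ∀ x, ‖c x‖ ≤ ρ)
    (w : List (Fin n ⊕ Fin n)) : ‖(w.map c).prod‖ ≤ ρ ^ w.length := by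
  induction w with
  | nil => simp
  | cons x w ih =>
    rw [List.map_cons, List.prod_cons, norm_mul, List.length_cons, pow_succ']
    exact mul_le_mul (hρ x) ih (norm_nonneg _) ((norm_nonneg _).trans (hρ x))

theorem exists_norm_le (c : Fin n ⊕ Fin n → ℂ) : ∃ ρ : ℝ, 0 ≤ ρ ∧ ∀ x, ‖c x‖ ≤ ρ :=
  ⟨‖c‖, norm_nonneg _, norm_le_pi_norm c⟩

theorem norm_der_comp_aff_le {c : Fin n ⊕ Fin n → ℂ} {b : ℂ} {φ : ℕ → ℂ → ℂ}
    (h : ∀ j x, HasDerivAt (φ j) (φ (j + 1) x) x) {p : Fin n → ℂ} {C ρ σ : ℝ} (hρ0 : 0 ≤ ρ)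
    (hρ : ∀ x, ‖c x‖ ≤ ρ) (hC : ∀ j, ‖φ j (aff c b p)‖ ≤ C * σ ^ j)
    (w : List (Fin n ⊕ Fin n)) :
    ‖der w (fun z => φ 0 (aff c b z)) p‖ ≤ C * (ρ * σ) ^ w.length := by
  rw [der_comp_aff c b h, norm_mul, zero_add]
  refine (mul_le_mul (norm_prod_map_le hρ w) (hC _) (norm_nonneg _)
    (by positivity)).trans_eq ?_
  ring

theorem isExpType_comp_aff (c : Fin n ⊕ Fin n → ℂ) (b : ℂ) {φ : ℕ → ℂ → ℂ}
    (h : ∀ j x, HasDerivAt (φ j) (φ (j + 1) x) x) {p : Fin n → ℂ} {C σ : ℝ} (hσ : 0 ≤ σ)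
    (hC : ∀ j, ‖φ j (aff c b p)‖ ≤ C * σ ^ j) : IsExpType p fun z => φ 0 (aff c b z) := by
  obtain ⟨ρ, hρ0, hρ⟩ := exists_norm_le c
  exact ⟨analyticOnNhd_comp_aff c b fun x => (h 0 x).differentiableAt, C, ρ * σ, by positivity,
    norm_der_comp_aff_le h hρ0 hρ hC⟩

theorem isExpType_exp_aff (c : Fin n ⊕ Fin n → ℂ) (b : ℂ) (p : Fin n → ℂ) :
    IsExpType p fun z => Complex.exp (aff c b z) :=
  isExpType_comp_aff c b (φ := fun _ => Complex.exp) (fun _ x => Complex.hasDerivAt_exp x)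
    zero_le_one (C := ‖Complex.exp (aff c b p)‖) fun j => by simp

end Affine

/-! ### The functions `∂_τ^k (τ^j exp (τ x + q τ²))` -/

section Gauss

/-- The derivative `∂_τ^k (τ^j exp (τ x + q τ²)) = ∂_τ^k ∂_x^j exp (τ x + q τ²)`. -/
def gauss (q : ℂ) : ℕ → ℕ → ℂ → ℂ → ℂ
  | 0, j, τ, x => τ ^ j * Complex.exp (τ * x + q * τ ^ 2)
  | k + 1, j, τ, x =>
    j * gauss q k (j - 1) τ x + x * gauss q k j τ x + 2 * q * gauss q k (j + 1) τ x

variable (q : ℂ)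

theorem hasDerivAt_gauss_left (k j : ℕ) (τ x : ℂ) :
    HasDerivAt (fun τ => gauss q k j τ x) (gauss q (k + 1) j τ x) τ := by
  induction k generalizing j with
  | zero =>
    simp only [gauss]
    have h1 : HasDerivAt (fun τ : ℂ => τ * x + q * τ ^ 2) (1 * x + q * ((2 : ℕ) * τ ^ (2 - 1))) τ :=
      ((hasDerivAt_id τ).mul_const x).add ((hasDerivAt_pow 2 τ).const_mul q)
    refine ((hasDerivAt_pow j τ).mul h1.cexp).congr_deriv ?_
    push_cast
    ring
  | succ k ih =>
    exact (((ih (j - 1)).const_mul (j : ℂ)).add ((ih j).const_mul x)).add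
      ((ih (j + 1)).const_mul (2 * q))

theorem hasDerivAt_gauss_right (k j : ℕ) (τ x : ℂ) :
    HasDerivAt (gauss q k j τ) (gauss q k (j + 1) τ x) x := by
  induction k generalizing j with
  | zero =>
    have h1 : HasDerivAt (fun x : ℂ => τ * x + q * τ ^ 2) (τ * 1) x :=
      ((hasDerivAt_id x).const_mul τ).add_const _
    refine (h1.cexp.const_mul (τ ^ j)).congr_deriv ?_
    simp only [gauss]
    ring
  | succ k ih =>
    have h := (((ih (j - 1)).const_mul (j : ℂ)).add ((hasDerivAt_id x).mul (ih j))).add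
      ((ih (j + 1)).const_mul (2 * q))
    refine h.congr_deriv ?_
    simp only [gauss, id]
    -- The truncated index `j - 1` occurs only with the factor `j`, so `j = 0` is treated apart.
    rcases j with _ | j
    · simp
    · simp
      ring

/-- This is the Leibniz rule for `∂_τ^k` applied to `τ · (τ^j exp (τ x + q τ²))`; only the first
derivative of the factor `τ` survives. -/
theorem gauss_succ_right (k j : ℕ) (τ x : ℂ) :
    gauss q k (j + 1) τ x = τ * gauss q k j τ x + k * gauss q (k - 1) j τ x := by
  induction k generalizing j with
  | zero =>
    simp only [gauss]
    push_cast
    ring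
  | succ k ih =>
    have h1 : (j : ℂ) * gauss q k j τ x = j * (τ * gauss q k (j - 1) τ x +
        k * gauss q (k - 1) (j - 1) τ x) := by
      rcases j with _ | j
      · simp
      · rw [ih]; rfl
    have h2 : (k : ℂ) * gauss q k j τ x = k * (j * gauss q (k - 1) (j - 1) τ x +
        x * gauss q (k - 1) j τ x + 2 * q * gauss q (k - 1) (j + 1) τ x) := by
      rcases k with _ | k
      · simp
      · rfl
    simp only [gauss, Nat.add_sub_cancel]
    rw [ih (j + 1), ih j]
    push_cast
    linear_combination h1 - h2

theorem iteratedDeriv_gauss (k j : ℕ) (x : ℂ) :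
    iteratedDeriv k (fun τ => gauss q 0 j τ x) = fun τ => gauss q k j τ x := by
  induction k with
  | zero => exact iteratedDeriv_zero
  | succ k ih =>
    rw [iteratedDeriv_succ, ih]
    funext τ
    exact (hasDerivAt_gauss_left q k j τ x).deriv

/-- Cauchy's estimate on the circle of radius `R` about `τ`, where `|σ| ≤ |τ| + R`. The free radius
trades decay `R^{-k}` in `k` against exponential growth in `j`. -/
theorem norm_gauss_le (k j : ℕ) (τ x : ℂ) {R : ℝ} (hR : 0 < R) :
    ‖gauss q k j τ x‖ ≤ k.factorial * (Real.exp ((‖τ‖ + R) * ‖x‖ + ‖q‖ * (‖τ‖ + R) ^ 2) *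
      (‖τ‖ + R) ^ j) / R ^ k := by
  have hd : Differentiable ℂ fun τ => gauss q 0 j τ x := fun τ =>
    (hasDerivAt_gauss_left q 0 j τ x).differentiableAt
  have key := Complex.norm_iteratedDeriv_le_of_forall_mem_sphere_norm_le (c := τ) k hR
    hd.diffContOnCl (C := Real.exp ((‖τ‖ + R) * ‖x‖ + ‖q‖ * (‖τ‖ + R) ^ 2) * (‖τ‖ + R) ^ j) ?_
  · rwa [iteratedDeriv_gauss] at key
  intro σ hσ
  have hσ' : ‖σ‖ ≤ ‖τ‖ + R := by
    rw [mem_sphere_iff_norm] at hσ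
    have := norm_add_le τ (σ - τ)
    rwa [add_sub_cancel, hσ] at this
  simp only [gauss]
  rw [norm_mul, norm_pow, mul_comm, Complex.norm_exp]
  gcongr
  refine (Complex.re_le_norm _).trans ((norm_add_le _ _).trans ?_)
  rw [norm_mul, norm_mul, norm_pow]
  gcongr

theorem hasSum_gauss (j : ℕ) (τ x : ℂ) :
    HasSum (fun k : ℕ => τ ^ k / (k.factorial : ℂ) * gauss q k j 0 x) (gauss q 0 j τ x) := by
  have hd : Differentiable ℂ fun τ => gauss q 0 j τ x := fun τ =>
    (hasDerivAt_gauss_left q 0 j τ x).differentiableAt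
  convert! Complex.hasSum_taylorSeries_of_entire hd 0 τ using 2 with k
  rw [iteratedDeriv_gauss, sub_zero, smul_eq_mul, smul_eq_mul]
  ring

theorem gauss_zero_zero (τ x : ℂ) : gauss q 0 0 τ x = Complex.exp (τ * x + q * τ ^ 2) := by
  simp [gauss]

/-- The recursion for the Hermite polynomials `∂_τ^k|_0 exp (τ x + q τ²)`. -/
theorem gauss_succ_zero (k : ℕ) (x : ℂ) : gauss q (k + 2) 0 0 x =
    x * gauss q (k + 1) 0 0 x + 2 * q * ((k + 1) * gauss q k 0 0 x) := by
  rw [gauss, gauss_succ_right]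
  simp

/-- The Hermite polynomial `∂_τ^k|_0 exp (τ x + q τ²)` divided by `k!`, explicitly. -/
def hermiteSum (q x : ℂ) (k : ℕ) : ℂ :=
  ∑ l ∈ Finset.range (k / 2 + 1), q ^ l * x ^ (k - 2 * l) /
    ((l.factorial : ℂ) * ((k - 2 * l).factorial : ℂ))

/-- The weight `k + 2` on the `l`-th term is split as `2l + (k + 2 - 2l)`. The first part cancels a
factor of `l!`, the second one of `(k + 2 - 2l)!`. -/
theorem hermiteSum_succ (x : ℂ) (k : ℕ) : (k + 2) * hermiteSum q x (k + 2) =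
    x * hermiteSum q x (k + 1) + 2 * q * hermiteSum q x k := by
  set c : ℕ → ℂ := fun l => q ^ l * x ^ (k + 2 - 2 * l) /
    ((l.factorial : ℂ) * ((k + 2 - 2 * l).factorial : ℂ)) with hc
  have e : (k + 2) / 2 + 1 = (k / 2 + 1) + 1 := by omega
  have h1 : ∑ l ∈ Finset.range ((k + 2) / 2 + 1), (2 * l : ℂ) * c l =
      2 * q * hermiteSum q x k := by
    rw [e, Finset.sum_range_succ', hermiteSum, Finset.mul_sum]
    simp only [Nat.cast_zero, mul_zero, zero_mul, add_zero]
    refine Finset.sum_congr rfl fun l _ => ?_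
    have h2 : k + 2 - 2 * (l + 1) = k - 2 * l := by omega
    have h3 : ((l : ℂ) + 1) ≠ 0 := Nat.cast_add_one_ne_zero l
    have h4 : ((l.factorial : ℕ) : ℂ) ≠ 0 := Nat.cast_ne_zero.2 l.factorial_ne_zero
    have h5 : (((k - 2 * l).factorial : ℕ) : ℂ) ≠ 0 := Nat.cast_ne_zero.2 (Nat.factorial_ne_zero _)
    simp only [hc, h2, Nat.factorial_succ]
    push_cast
    field_simp
    ring
  have h2 : ∑ l ∈ Finset.range ((k + 2) / 2 + 1), (k + 2 - 2 * l : ℂ) * c l =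
      x * hermiteSum q x (k + 1) := by
    rw [hermiteSum, Finset.mul_sum]
    symm
    rw [← Finset.sum_subset (Finset.range_subset_range.2
      (show (k + 1) / 2 + 1 ≤ (k + 2) / 2 + 1 by omega))]
    · refine Finset.sum_congr rfl fun l hl => ?_
      rw [Finset.mem_range] at hl
      obtain ⟨m, hm⟩ : ∃ m, k + 1 = 2 * l + m := ⟨k + 1 - 2 * l, by omega⟩
      have e1 : k + 1 - 2 * l = m := by omega
      have e2 : k + 2 - 2 * l = m + 1 := by omega
      have e3 : (k + 2 - 2 * l : ℂ) = m + 1 := by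
        have : ((k + 1 : ℕ) : ℂ) = ((2 * l + m : ℕ) : ℂ) := by rw [hm]
        push_cast at this
        linear_combination this
      have h3 : ((m : ℂ) + 1) ≠ 0 := Nat.cast_add_one_ne_zero m
      have h4 : ((l.factorial : ℕ) : ℂ) ≠ 0 := Nat.cast_ne_zero.2 l.factorial_ne_zero
      have h5 : ((m.factorial : ℕ) : ℂ) ≠ 0 := Nat.cast_ne_zero.2 (Nat.factorial_ne_zero _)
      simp only [hc]
      rw [e3, e1, e2, Nat.factorial_succ]
      push_cast
      field_simp
      ring
    -- For even `k` the left sum has one extra term, `2l = k + 2`, whose weight is zero.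
    · intro l hl hl'
      rw [Finset.mem_range] at hl hl'
      have e1 : k + 2 = 2 * l := by omega
      have : ((k + 2 : ℕ) : ℂ) = ((2 * l : ℕ) : ℂ) := by rw [e1]
      push_cast at this
      rw [this, sub_self, zero_mul]
  rw [← h1, ← h2, ← Finset.sum_add_distrib, hermiteSum, Finset.mul_sum]
  refine Finset.sum_congr rfl fun l _ => ?_
  simp only [hc]
  ring

theorem gauss_eq_hermiteSum (k : ℕ) (x : ℂ) :
    gauss q k 0 0 x = k.factorial * hermiteSum q x k := by
  induction k using Nat.strong_induction_on with
  | _ k ih =>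
    match k with
    | 0 => simp [gauss, hermiteSum]
    | 1 => simp [gauss, hermiteSum]
    | k + 2 =>
      rw [gauss_succ_zero, ih k (by omega), ih (k + 1) (by omega)]
      have := hermiteSum_succ q x k
      simp only [Nat.factorial_succ]
      push_cast
      linear_combination -((k : ℂ) + 1) * k.factorial * this

end Gauss

/-! ### Star products of functions of affine forms -/

section Tower

/-- `φ` is the sequence of derivatives of an entire function of exponential type. -/
def IsTower (φ : ℕ → ℂ → ℂ) : Prop :=
  (∀ j x, HasDerivAt (φ j) (φ (j + 1) x) x) ∧
    ∀ x, ∃ C σ : ℝ, 0 ≤ σ ∧ ∀ j, ‖φ j x‖ ≤ C * σ ^ j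

theorem isTower_exp : IsTower fun _ => Complex.exp :=
  ⟨fun _ x => Complex.hasDerivAt_exp x, fun x => ⟨_, 1, zero_le_one, fun j => by
    rw [one_pow, mul_one]⟩⟩

theorem isTower_gauss (q : ℂ) (k : ℕ) (τ : ℂ) : IsTower fun j => gauss q k j τ := by
  refine ⟨fun j x => hasDerivAt_gauss_right q k j τ x, fun x =>
    ⟨k.factorial * Real.exp ((‖τ‖ + 1) * ‖x‖ + ‖q‖ * (‖τ‖ + 1) ^ 2), ‖τ‖ + 1, by positivity,
      fun j => (norm_gauss_le q k j τ x one_pos).trans_eq ?_⟩⟩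
  rw [one_pow, div_one, mul_assoc]

/-- The derivatives of the identity. -/
def idTower : ℕ → ℂ → ℂ
  | 0, x => x
  | 1, _ => 1
  | _ + 2, _ => 0

theorem isTower_id : IsTower idTower := by
  refine ⟨fun j x => ?_, fun x => ⟨‖x‖ + 1, 1, zero_le_one, fun j => ?_⟩⟩
  · match j with
    | 0 => exact hasDerivAt_id x
    | 1 => exact hasDerivAt_const x _
    | _ + 2 => exact hasDerivAt_const x _
  · match j with
    | 0 => simp [idTower]
    | 1 => simp [idTower]
    | _ + 2 =>
      simp only [idTower, norm_zero]
      positivity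

variable {φ ψ : ℕ → ℂ → ℂ}

theorem IsTower.shift (hφ : IsTower φ) (m : ℕ) : IsTower fun j => φ (m + j) := by
  refine ⟨fun j x => hφ.1 (m + j) x, fun x => ?_⟩
  obtain ⟨C, σ, hσ, h⟩ := hφ.2 x
  exact ⟨C * σ ^ m, σ, hσ, fun j => (h (m + j)).trans_eq (by ring)⟩

theorem IsTower.isExpType (hφ : IsTower φ) (j : ℕ) (c : Fin n ⊕ Fin n → ℂ) (b : ℂ)
    (p : Fin n → ℂ) : IsExpType p fun z => φ j (aff c b z) := by
  obtain ⟨C, σ, hσ, h⟩ := (hφ.shift j).2 (aff c b p)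
  exact isExpType_comp_aff c b (φ := fun i => φ (j + i)) (hφ.shift j).1 hσ h

/-- Each derivative moves one step up the tower and releases one coefficient, so `N` enters the
tower only through `|N|`. -/
theorem wickTerm_comp_aff (hbar : ℝ) (hφ : IsTower φ) (hψ : IsTower ψ)
    (c c' : Fin n ⊕ Fin n → ℂ) (b b' : ℂ) (N : Fin n → ℕ) :
    wickTerm hbar (fun z => φ 0 (aff c b z)) (fun z => ψ 0 (aff c' b' z)) N =
      ((2 * hbar : ℂ) ^ mdeg N / (mfact N : ℂ) * (∏ k, c (.inl k) ^ N k) *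
        ∏ k, c' (.inr k) ^ N k) •
      ((fun z => φ (mdeg N) (aff c b z)) * fun z => ψ (mdeg N) (aff c' b' z)) := by
  funext z
  rw [wickTerm, wirtinger_comp_aff c b hφ.1, wirtinger_comp_aff c' b' hψ.1]
  have : mdeg (0 : Fin n → ℕ) = 0 := by simp [mdeg]
  simp only [Pi.smul_apply, Pi.mul_apply, smul_eq_mul, Pi.zero_apply, pow_zero,
    Finset.prod_const_one, this, add_zero, zero_add, mul_one, one_mul]
  ring

theorem isExpType_wickTerm (hbar : ℝ) (hφ : IsTower φ) (hψ : IsTower ψ)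
    (c c' : Fin n ⊕ Fin n → ℂ) (b b' : ℂ) (N : Fin n → ℕ) (p : Fin n → ℂ) :
    IsExpType p
      (wickTerm hbar (fun z => φ 0 (aff c b z)) (fun z => ψ 0 (aff c' b' z)) N) := by
  rw [wickTerm_comp_aff hbar hφ hψ]
  exact ((hφ.isExpType _ c b p).mul (hψ.isExpType _ c' b' p)).smul _

theorem two_le_mdeg {N : Fin n → ℕ} (h0 : N ≠ 0) (h1 : ∀ k, N ≠ Pi.single k 1) :
    2 ≤ mdeg N := by
  obtain ⟨k, hk⟩ := Function.ne_iff.1 h0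
  obtain ⟨j, hj⟩ := Function.ne_iff.1 (h1 k)
  rw [Pi.zero_apply] at hk
  rcases eq_or_ne j k with rfl | hjk
  · rw [Pi.single_eq_same] at hj
    have := Finset.single_le_sum (f := N) (fun _ _ => Nat.zero_le _) (Finset.mem_univ j)
    unfold mdeg
    omega
  · rw [Pi.single_eq_of_ne hjk] at hj
    have := Finset.sum_le_sum_of_subset (f := N) (Finset.subset_univ {j, k})
    rw [Finset.sum_pair hjk] at this
    unfold mdeg
    omega

/-- The Wick star product of functions of affine forms, if one of the factors is affine. -/
theorem isStarProduct_of_tower {hbar : ℝ} {p : Fin n → ℂ} (hφ : IsTower φ) (hψ : IsTower ψ)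
    (hvan : ∀ j x y, φ (j + 2) x * ψ (j + 2) y = 0) {c c' : Fin n ⊕ Fin n → ℂ} {b b' : ℂ}
    {f g h : WickSpace hbar p} (hf : ⇑f = fun z => φ 0 (aff c b z))
    (hg : ⇑g = fun z => ψ 0 (aff c' b' z))
    (hh : ∀ z, h z = φ 0 (aff c b z) * ψ 0 (aff c' b' z) +
      (2 * hbar * ∑ k, c (.inl k) * c' (.inr k)) *
        (φ 1 (aff c b z) * ψ 1 (aff c' b' z))) : IsStarProduct f g h := by
  have hT : ∀ N, IsExpType p (wickTerm hbar f g N) := fun N => by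
    rw [hf, hg]
    exact isExpType_wickTerm hbar hφ hψ c c' b b' N p
  set T : (Fin n → ℕ) → WickSpace hbar p := fun N => WickSpace.ofExpType hbar _ (hT N) with hTdef
  classical
  -- Only `N = 0` and the unit vectors contribute: otherwise `|N| ≥ 2` and `hvan` kills the summand.
  set s : Finset (Fin n → ℕ) := insert 0 (Finset.univ.image fun k => Pi.single k 1) with hs
  have hzero : ∀ N ∉ s, T N = 0 := by
    intro N hN
    simp only [hs, Finset.mem_insert, Finset.mem_image, Finset.mem_univ, true_and, not_or,
      not_exists] at hN
    obtain ⟨j, hj⟩ := Nat.exists_eq_add_of_le' (two_le_mdeg hN.1 fun k => Ne.symm (hN.2 k))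
    apply DFunLike.coe_injective
    change wickTerm hbar f g N = 0
    rw [hf, hg, wickTerm_comp_aff hbar hφ hψ, hj]
    funext z
    simp [hvan]
  have hsum : ∑ N ∈ s, T N = h := by
    apply DFunLike.coe_injective
    rw [WickSpace.coe_sum]
    funext z
    have hmem : (0 : Fin n → ℕ) ∉ Finset.univ.image fun k : Fin n => Pi.single k 1 := by
      simp
    rw [Finset.sum_apply, hs, Finset.sum_insert hmem, Finset.sum_image (fun i _ j _ hij => by
      by_contra hne
      have := congrFun hij i
      rw [Pi.single_eq_same, Pi.single_eq_of_ne hne] at this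
      omega), hh]
    simp only [hTdef, WickSpace.coe_ofExpType]
    rw [hf, hg]
    simp only [wickTerm_comp_aff hbar hφ hψ, Pi.smul_apply, Pi.mul_apply, smul_eq_mul]
    have e0 : mdeg (0 : Fin n → ℕ) = 0 := by simp [mdeg]
    have e1 : ∀ k : Fin n, mdeg (Pi.single k 1) = 1 := fun k => by simp [mdeg]
    have f0 : mfact (0 : Fin n → ℕ) = 1 := by simp [mfact]
    have f1 : ∀ k : Fin n, mfact (Pi.single k 1) = 1 := fun k => by
      refine Finset.prod_eq_one fun j _ => ?_
      rcases eq_or_ne j k with rfl | hjk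
      · simp
      · simp [hjk]
    have p1 : ∀ (a : Fin n → ℂ) (k : Fin n), ∏ j, a j ^ (Pi.single k 1 : Fin n → ℕ) j = a k := by
      intro a k
      rw [Finset.prod_eq_single k]
      · simp
      · intro j _ hjk
        simp [hjk]
      · simp
    simp only [e0, e1, f0, f1, p1 (fun j => c (.inl j)), p1 (fun j => c' (.inr j)),
      Pi.zero_apply, pow_zero, Finset.prod_const_one, Nat.cast_one, div_one, mul_one, one_mul,
      pow_one]
    rw [Finset.mul_sum, Finset.sum_mul]
    congr 1
    exact Finset.sum_congr rfl fun k _ => by ring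
  refine ⟨T, fun N => rfl, fun i => summable_of_ne_finset_zero (s := s) fun N hN => ?_, ?_⟩
  · rw [hzero N hN, map_zero]
  · rw [← hsum]
    exact hasSum_sum_of_ne_finset_zero hzero

/-- The Wick star product of two exponentials of affine forms. -/
theorem isStarProduct_exp {hbar : ℝ} {p : Fin n → ℂ} {c c' : Fin n ⊕ Fin n → ℂ} {b b' : ℂ}
    {f g h : WickSpace hbar p} (hf : ⇑f = fun z => Complex.exp (aff c b z))
    (hg : ⇑g = fun z => Complex.exp (aff c' b' z))
    (hh : ∀ z, h z = Complex.exp (2 * hbar * ∑ k, c (.inl k) * c' (.inr k)) *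
      (Complex.exp (aff c b z) * Complex.exp (aff c' b' z))) : IsStarProduct f g h := by
  have hE : IsExpType p ((fun z => Complex.exp (aff c b z)) *
      fun z => Complex.exp (aff c' b' z)) :=
    (isExpType_exp_aff c b p).mul (isExpType_exp_aff c' b' p)
  -- The exponential is its own derivative, so every summand is a scalar multiple of this one
  -- element.
  set E : WickSpace hbar p := WickSpace.ofExpType hbar _ hE with hEdef
  obtain ⟨h1, h2⟩ := summable_norm_and_hasSum_prod_pow_div_factorial
    fun k : Fin n => 2 * (hbar : ℂ) * (c (.inl k) * c' (.inr k))
  refine ⟨fun N => (∏ k, (2 * (hbar : ℂ) * (c (.inl k) * c' (.inr k))) ^ N k /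
    ((N k).factorial : ℂ)) • E, fun N => ?_, fun i => ?_, ?_⟩
  · rw [hf, hg]
    rw [wickTerm_comp_aff hbar (φ := fun _ => Complex.exp) (ψ := fun _ => Complex.exp)
      isTower_exp isTower_exp, WickSpace.coe_smul, pow_mdeg_div_mfact,
      ← Finset.prod_mul_distrib, ← Finset.prod_mul_distrib]
    congr 1
    refine Finset.prod_congr rfl fun k _ => ?_
    rw [mul_pow, mul_pow]
    ring
  · simp only [map_smul_eq_mul]
    exact h1.mul_right _
  · have : h = Complex.exp (∑ k, 2 * (hbar : ℂ) * (c (.inl k) * c' (.inr k))) • E := by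
      apply DFunLike.coe_injective
      funext z
      rw [hh, Finset.mul_sum]
      rfl
    rw [this]
    exact h2.smul_const E

end Tower

/-! ### Taylor expansion of Gaussians of affine forms -/

section Taylor

/-- The Taylor series in `τ` converges in `𝒜_ħ`, also after multiplication by a fixed `g`. With `g =
1` it gives the star exponential, with `g = u_g` and `τ = 1` the power series about `g`. -/
theorem hasSum_gauss_mul {hbar : ℝ} {p : Fin n → ℂ} (q τ : ℂ) (c : Fin n ⊕ Fin n → ℂ) (b : ℂ)
    {g : (Fin n → ℂ) → ℂ} (hg : IsExpType p g) {T : ℕ → WickSpace hbar p}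
    {s : WickSpace hbar p}
    (hT : ∀ k z, T k z = τ ^ k / (k.factorial : ℂ) * gauss q k 0 0 (aff c b z) * g z)
    (hs : ∀ z, s z = gauss q 0 0 τ (aff c b z) * g z) : HasSum T s := by
  obtain ⟨hg1, D, σ, hσ, hD⟩ := hg
  obtain ⟨ρ, hρ0, hρ⟩ := exists_norm_le c
  set t : ℕ → (Fin n → ℂ) → ℂ := fun k =>
    (τ ^ k / (k.factorial : ℂ)) • fun z => gauss q k 0 0 (aff c b z) with ht
  have hsm : ∀ k, ContDiff ℝ ∞ fun z => gauss q k 0 0 (aff c b z) := fun k =>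
    ((isTower_gauss q k 0).isExpType 0 c b p).contDiff
  have htsm : ∀ k, ContDiff ℝ ∞ (t k) := fun k => contDiff_const.smul (hsm k)
  have hssm : ContDiff ℝ ∞ fun z => gauss q 0 0 τ (aff c b z) :=
    ((isTower_gauss q 0 τ).isExpType 0 c b p).contDiff
  have hT' : ∀ k, ⇑(T k) = t k * g := fun k => funext fun z => hT k z
  have hs' : ⇑s = (fun z => gauss q 0 0 τ (aff c b z)) * g := funext hs
  have hder : ∀ k w, der w (t k) p = τ ^ k / (k.factorial : ℂ) *
      ((w.map c).prod * gauss q k w.length 0 (aff c b p)) := fun k w => by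
    rw [ht, (smoothLinear_der w).2.2 _ _ (hsm k), Pi.smul_apply, smul_eq_mul,
      der_comp_aff c b (isTower_gauss q k 0).1, zero_add]
  -- Any Cauchy radius above `|τ|` works: the majorant is geometric with ratio `|τ| / R < 1`.
  set R : ℝ := ‖τ‖ + 1 with hR
  have hR0 : 0 < R := by positivity
  set M : ℝ := Real.exp (R * ‖aff c b p‖ + ‖q‖ * R ^ 2)
  have hbd : ∀ k w, ‖der w (t k) p‖ ≤ (M * (‖τ‖ / R) ^ k) * (ρ * R) ^ w.length := by
    intro k w
    have h1 := norm_gauss_le q k w.length 0 (aff c b p) hR0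
    rw [norm_zero, zero_add] at h1
    rw [hder, norm_mul, norm_mul, norm_div, norm_pow, Complex.norm_natCast]
    have hk : (0 : ℝ) < k.factorial := by positivity
    calc _ ≤ ‖τ‖ ^ k / k.factorial * (ρ ^ w.length *
          (k.factorial * (M * R ^ w.length) / R ^ k)) := by
          gcongr
          exact norm_prod_map_le hρ w
      _ = _ := by
          rw [mul_pow, div_pow]
          field_simp
  refine WickSpace.hasSum_of_der (ρ := ρ * R + σ) (c := fun k => M * (‖τ‖ / R) ^ k * D)
    (by positivity) ?_ (fun k w => ?_) fun w => ?_
  · refine ((summable_geometric_of_lt_one (by positivity) ?_).mul_left M).mul_right D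
    rw [div_lt_one hR0]
    exact lt_add_one _
  · rw [hT']
    exact norm_der_mul_le (htsm k) hg1.contDiff (hbd k) hD w
  · simp only [hT', hs']
    refine hasSum_der_mul htsm hssm hg1.contDiff (fun w => ?_) w
    rw [der_comp_aff c b (isTower_gauss q 0 τ).1, zero_add]
    refine ((hasSum_gauss q w.length τ (aff c b p)).mul_left (w.map c).prod).congr_fun ?_
    intro k
    rw [hder]
    ring

end Taylor

/-! ### Derivatives of Gaussian curves -/

section Curve

/-- The mean value inequality is used twice, for `f'` and then for `f y - y f'(t)`; the missing
factor `1/2` is irrelevant. -/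
theorem norm_sub_sub_le_of_deriv2 {f f' f'' : ℝ → ℂ} (h1 : ∀ x, HasDerivAt f (f' x) x)
    (h2 : ∀ x, HasDerivAt f' (f'' x) x) {t x M : ℝ}
    (hM : ∀ y, |y - t| ≤ |x - t| → ‖f'' y‖ ≤ M) :
    ‖f x - f t - (x - t : ℝ) * f' t‖ ≤ M * |x - t| ^ 2 := by
  set s := Metric.closedBall t |x - t|
  have hs : Convex ℝ s := convex_closedBall _ _
  have hts : t ∈ s := Metric.mem_closedBall_self (abs_nonneg _)
  have hxs : x ∈ s := by simp [s, Real.dist_eq]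
  have hmem : ∀ y ∈ s, |y - t| ≤ |x - t| := fun y hy => by
    simpa [s, Real.dist_eq] using hy
  have hM0 : 0 ≤ M := (norm_nonneg _).trans (hM t (by simp))
  have b1 : ∀ y ∈ s, ‖f' y - f' t‖ ≤ M * |x - t| := fun y hy => by
    have := hs.norm_image_sub_le_of_norm_hasDerivWithin_le
      (fun z _ => (h2 z).hasDerivWithinAt) (fun z hz => hM z (hmem z hz)) hts hy
    refine this.trans ?_
    rw [Real.norm_eq_abs]
    exact mul_le_mul_of_nonneg_left (hmem y hy) hM0
  have h3 : ∀ y, HasDerivAt (fun y : ℝ => f y - (y : ℂ) * f' t) (f' y - f' t) y := fun y => by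
    have := (h1 y).sub ((Complex.ofRealCLM.hasDerivAt (x := y)).mul_const (f' t))
    refine this.congr_deriv ?_
    simp
  have := hs.norm_image_sub_le_of_norm_hasDerivWithin_le
    (fun z _ => (h3 z).hasDerivWithinAt) b1 hts hxs
  rw [Real.norm_eq_abs] at this
  refine (le_of_eq ?_).trans (this.trans_eq (by ring))
  push_cast
  ring_nf

theorem hasDerivAt_gauss_comp_aff {hbar : ℝ} {p : Fin n → ℂ} (q : ℂ) (c : Fin n ⊕ Fin n → ℂ)
    (b : ℂ) (k : ℕ) {γ γ' : ℝ → WickSpace hbar p}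
    (hγ : ∀ t : ℝ, ⇑(γ t) = fun z => gauss q k 0 t (aff c b z))
    (hγ' : ∀ t : ℝ, ⇑(γ' t) = fun z => gauss q (k + 1) 0 t (aff c b z)) (t : ℝ) :
    HasDerivAt γ (γ' t) t := by
  obtain ⟨ρ, hρ0, hρ⟩ := exists_norm_le c
  have hder : ∀ k w (x : ℝ), der w (fun z => gauss q k 0 x (aff c b z)) p =
      (w.map c).prod * gauss q k w.length x (aff c b p) := fun k w x => by
    rw [der_comp_aff c b (isTower_gauss q k x).1, zero_add]
  -- One unit for `|x - t| ≤ 1` and one for the Cauchy radius.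
  set R : ℝ := |t| + 2 with hR
  set M : ℝ := (k + 2).factorial * Real.exp (R * ‖aff c b p‖ + ‖q‖ * R ^ 2) with hM
  refine WickSpace.hasDerivAt_of_der (C := M) (ρ := ρ * R) (by positivity) fun x hx w => ?_
  simp only [WickSpace.derₗ_apply, hγ, hγ', hder]
  have hd : ∀ k (x : ℝ), HasDerivAt (fun x : ℝ => gauss q k w.length x (aff c b p))
      (gauss q (k + 1) w.length x (aff c b p)) x := fun k x =>
    (hasDerivAt_gauss_left q k w.length x (aff c b p)).comp_ofReal
  have key := norm_sub_sub_le_of_deriv2 (hd k) (hd (k + 1)) (t := t) (x := x)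
    (M := M * R ^ w.length) fun y hy => by
      refine (norm_gauss_le q (k + 2) w.length y (aff c b p) one_pos).trans ?_
      have hy' : ‖(y : ℂ)‖ + 1 ≤ R := by
        rw [Complex.norm_real, Real.norm_eq_abs]
        have := abs_add_le t (y - t)
        rw [add_sub_cancel] at this
        rw [hR]
        linarith
      rw [one_pow, div_one, hM, mul_assoc]
      gcongr
  calc _ = ‖(w.map c).prod‖ * ‖gauss q k w.length x (aff c b p) -
        gauss q k w.length t (aff c b p) -
          (x - t : ℝ) * gauss q (k + 1) w.length t (aff c b p)‖ := by
        rw [← norm_mul]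
        congr 1
        ring
    _ ≤ ρ ^ w.length * (M * R ^ w.length * |x - t| ^ 2) := by
        gcongr
        exact norm_prod_map_le hρ w
    _ = _ := by
        rw [mul_pow]
        ring

end Curve

/-! ### Multilinear Hermite polynomials -/

section Hermite

variable {V A : Type*} [AddCommGroup V] [Module ℝ V] [CommRing A] [Algebra ℝ A]

/-- The multilinear map `v ↦ L v₀ * f (v₁, …, vₖ)`. -/
def consMul (L : V →ₗ[ℝ] A) {k : ℕ} (f : MultilinearMap ℝ (fun _ : Fin k => V) A) :
    MultilinearMap ℝ (fun _ : Fin (k + 1) => V) A :=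
  LinearMap.uncurryLeft
    { toFun := fun y => (LinearMap.mulLeft ℝ (L y)).compMultilinearMap f
      map_add' := fun x y => by ext; simp [add_mul]
      map_smul' := fun c y => by ext; simp }

theorem consMul_apply (L : V →ₗ[ℝ] A) {k : ℕ} (f : MultilinearMap ℝ (fun _ : Fin k => V) A)
    (v : Fin (k + 1) → V) : consMul L f v = L (v 0) * f (Fin.tail v) := rfl

/-- The multilinear map `v ↦ q v₀ v₁ * f (v₂, …, vₖ₊₁)`. -/
def consConsMul (q : V →ₗ[ℝ] V →ₗ[ℝ] A) {k : ℕ}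
    (f : MultilinearMap ℝ (fun _ : Fin k => V) A) :
    MultilinearMap ℝ (fun _ : Fin (k + 1 + 1) => V) A :=
  LinearMap.uncurryLeft
    { toFun := fun y => consMul (q y) f
      map_add' := fun x y => by ext; simp [consMul_apply, add_mul]
      map_smul' := fun c y => by ext; simp [consMul_apply] }

theorem consConsMul_apply (q : V →ₗ[ℝ] V →ₗ[ℝ] A) {k : ℕ}
    (f : MultilinearMap ℝ (fun _ : Fin k => V) A) (v : Fin (k + 1 + 1) → V) :
    consConsMul q f v = q (v 0) (v 1) * f (Fin.tail (Fin.tail v)) := rfl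

/-- Multilinear maps whose values on the diagonal are the homogeneous parts of
`exp (L y + q y y)`. -/
def hermiteMul (L : V →ₗ[ℝ] A) (q : V →ₗ[ℝ] V →ₗ[ℝ] A) :
    (k : ℕ) → MultilinearMap ℝ (fun _ : Fin k => V) A
  | 0 => MultilinearMap.constOfIsEmpty ℝ _ 1
  | 1 => consMul L (MultilinearMap.constOfIsEmpty ℝ _ 1)
  | k + 2 => (1 / ((k : ℝ) + 2)) •
      (consMul L (hermiteMul L q (k + 1)) + (2 : ℝ) • consConsMul q (hermiteMul L q k))

variable (L : V →ₗ[ℝ] (Fin n → ℂ) → ℂ) (q : V →ₗ[ℝ] V →ₗ[ℝ] (Fin n → ℂ) → ℂ)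

theorem hermiteMul_add_two (k : ℕ) (v : Fin (k + 2) → V) :
    hermiteMul L q (k + 2) v = ((1 / ((k : ℝ) + 2) : ℝ) : ℂ) •
      (L (v 0) * hermiteMul L q (k + 1) (Fin.tail v) +
        (2 : ℂ) • (q (v 0) (v 1) * hermiteMul L q k (Fin.tail (Fin.tail v)))) := by
  funext z
  simp [hermiteMul, consMul_apply, consConsMul_apply]
  ring

/-- The factor `1/(k + 2)` turns the Hermite recursion into that of `P_k / k!`. The maps need not be
symmetric, since a power series sees only the diagonal. -/
theorem hermiteMul_diag (y : V) (k : ℕ) (z : Fin n → ℂ) :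
    hermiteMul L q k (fun _ => y) z =
      1 / (k.factorial : ℂ) * gauss (q y y z) k 0 0 (L y z) := by
  induction k using Nat.strong_induction_on with
  | _ k ih =>
    match k with
    | 0 => simp [gauss, hermiteMul]
    | 1 => simp [gauss, hermiteMul, consMul_apply]
    | k + 2 =>
      have e1 := ih (k + 1) (by omega)
      have e2 := ih k (by omega)
      rw [hermiteMul_add_two, gauss_succ_zero]
      simp only [Pi.smul_apply, Pi.add_apply, Pi.mul_apply, smul_eq_mul]
      change _ * (L y z * hermiteMul L q (k + 1) (fun _ => y) z +
        2 * (q y y z * hermiteMul L q k (fun _ => y) z)) = _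
      rw [e1, e2]
      have h1 : (k.factorial : ℂ) ≠ 0 := Nat.cast_ne_zero.2 k.factorial_ne_zero
      have h2 : (k : ℂ) + 1 ≠ 0 := Nat.cast_add_one_ne_zero k
      have h3 : (k : ℂ) + 2 ≠ 0 := by
        have := Nat.cast_add_one_ne_zero (R := ℂ) (k + 1)
        push_cast at this
        rwa [add_assoc, one_add_one_eq_two] at this
      have h4 : (k : ℂ) + 1 + 1 ≠ 0 := by rwa [add_assoc, one_add_one_eq_two]
      simp only [Nat.factorial_succ]
      push_cast
      field_simp
      ring

end Hermite

/-! ### Cauchy estimates for the multilinear Hermite maps. -/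

section HermiteBound

theorem dir_const (x : Fin n ⊕ Fin n) (a : ℂ) : dir x (fun _ : Fin n → ℂ => a) = 0 := by
  funext z
  cases x <;> simp [dir, dz, dzbar]

theorem der_const {w : List (Fin n ⊕ Fin n)} (hw : w ≠ []) (a : ℂ) :
    der w (fun _ : Fin n → ℂ => a) = 0 := by
  obtain ⟨x, w, rfl⟩ := List.exists_cons_of_ne_nil hw
  rw [der, dir_const]
  have := (smoothLinear_der w).2.2 0 (0 : (Fin n → ℂ) → ℂ) contDiff_const
  simpa using this

theorem dir_aff (c : Fin n ⊕ Fin n → ℂ) (b : ℂ) (x : Fin n ⊕ Fin n) :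
    dir x (aff c b) = fun _ => c x := by
  have := dir_comp_aff c b (φ := id) (φ' := fun _ => 1) hasDerivAt_id x
  simpa using this

theorem contDiff_aff (c : Fin n ⊕ Fin n → ℂ) (b : ℂ) : ContDiff ℝ ∞ (aff c b) :=
  contDiff_const.add (linForm c).contDiff

theorem der_const_mul (w : List (Fin n ⊕ Fin n)) (a : ℂ) {f : (Fin n → ℂ) → ℂ}
    (hf : ContDiff ℝ ∞ f) : der w ((fun _ => a) * f) = a • der w f :=
  (smoothLinear_der w).2.2 a f hf

/-- In the Leibniz expansion at most one of the `d` letters can hit the affine factor, giving one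
term of order `d` and `d` terms of order `d - 1` in `f`. -/
theorem norm_der_aff_mul_le {c : Fin n ⊕ Fin n → ℂ} {b : ℂ} {p : Fin n → ℂ} {Λ : ℝ}
    (hc : ∀ x, ‖c x‖ ≤ Λ) (hb : ‖aff c b p‖ ≤ Λ) (d : ℕ) {f : (Fin n → ℂ) → ℂ}
    (hf : ContDiff ℝ ∞ f) {B B' : ℝ} (hB : ∀ w, w.length = d → ‖der w f p‖ ≤ B)
    (hB' : ∀ w, w.length + 1 = d → ‖der w f p‖ ≤ B') (w : List (Fin n ⊕ Fin n))
    (hw : w.length = d) : ‖der w (aff c b * f) p‖ ≤ Λ * (B + d * B') := by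
  have hΛ : 0 ≤ Λ := (norm_nonneg _).trans hb
  induction w generalizing d f with
  | nil =>
    subst hw
    simp only [der, Pi.mul_apply, norm_mul, List.length_nil, Nat.cast_zero, zero_mul, add_zero]
    exact mul_le_mul hb (hB [] rfl) (norm_nonneg _) hΛ
  | cons x w ih =>
    subst hw
    rw [der_cons_mul x w (contDiff_aff c b) hf, dir_aff, der_const_mul w _ hf]
    have h1 : ‖(c x • der w f) p‖ ≤ Λ * B' := by
      rw [Pi.smul_apply, norm_smul]
      exact mul_le_mul (hc x) (hB' w rfl) (norm_nonneg _) hΛ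
    have h2 := ih w.length ((smoothLinear_dir x).1 f hf) (fun u hu => hB (x :: u) (by simp [hu]))
      (fun u hu => hB' (x :: u) (by simpa using hu)) rfl
    refine (norm_add_le _ _).trans ((add_le_add h1 h2).trans_eq ?_)
    rw [List.length_cons]
    push_cast
    ring

variable {V : Type*} [NormedAddCommGroup V] [NormedSpace ℝ V]
  (L : V →ₗ[ℝ] (Fin n → ℂ) → ℂ) (q : V →ₗ[ℝ] V →ₗ[ℝ] (Fin n → ℂ) → ℂ)

theorem analyticOnNhd_hermiteMul (hL : ∀ y, AnalyticOnNhd ℝ (L y) Set.univ)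
    (hq : ∀ y y', AnalyticOnNhd ℝ (q y y') Set.univ) (k : ℕ) (v : Fin k → V) :
    AnalyticOnNhd ℝ (hermiteMul L q k v) Set.univ := by
  induction k using Nat.strong_induction_on with
  | _ k ih =>
    match k with
    | 0 => exact fun z _ => analyticAt_const
    | 1 => exact (hL (v 0)).mul fun z _ => analyticAt_const
    | k + 2 =>
      rw [hermiteMul_add_two]
      have h1 := (hL (v 0)).mul (ih (k + 1) (by omega) (Fin.tail v))
      have h2 := (hq (v 0) (v 1)).mul (ih k (by omega) (Fin.tail (Fin.tail v)))
      exact fun z hz => analyticAt_const.smul ((h1 z hz).add (analyticAt_const.smul (h2 z hz)))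

/-- The degree in `z` is at most `k`, so longer words give zero. This vanishing controls the factor
`d` from the Leibniz rule: the recursion's `1/(k + 2)` compensates it exactly, and no constant is
lost from one `k` to the next. -/
theorem norm_der_hermiteMul_le {p : Fin n → ℂ} {Λ : ℝ} (hΛ : 0 ≤ Λ)
    (hL : ∀ y, ∃ c b, L y = aff c b ∧ (∀ x, ‖c x‖ ≤ Λ * ‖y‖) ∧ ‖aff c b p‖ ≤ Λ * ‖y‖)
    (hq : ∀ y y', ∃ a, q y y' = (fun _ => a) ∧ 2 * ‖a‖ ≤ Λ ^ 2 * (‖y‖ * ‖y'‖)) (k : ℕ)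
    (v : Fin k → V) (w : List (Fin n ⊕ Fin n)) :
    ‖der w (hermiteMul L q k v) p‖ ≤ if w.length ≤ k then Λ ^ k * ∏ i, ‖v i‖ else 0 := by
  have hLa : ∀ y, AnalyticOnNhd ℝ (L y) Set.univ := fun y => by
    obtain ⟨c, b, h, -⟩ := hL y
    rw [h]
    exact analyticOnNhd_comp_aff c b differentiable_id
  have hqa : ∀ y y', AnalyticOnNhd ℝ (q y y') Set.univ := fun y y' => by
    obtain ⟨a, h, -⟩ := hq y y'
    rw [h]
    exact fun z _ => analyticAt_const
  have hsm : ∀ k v, ContDiff ℝ ∞ (hermiteMul L q k v) := fun k v =>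
    (analyticOnNhd_hermiteMul L q hLa hqa k v).contDiff
  induction k using Nat.strong_induction_on generalizing w with
  | _ k ih =>
    match k with
    | 0 =>
      rcases eq_or_ne w [] with rfl | hw
      · simp [der, hermiteMul]
      · have : der w (hermiteMul L q 0 v) = 0 := der_const hw 1
        rw [this]
        simp [hw]
    | 1 =>
      obtain ⟨c, b, hcb, h1, h2⟩ := hL (v 0)
      have hB : ∀ u : List (Fin n ⊕ Fin n), ‖der u (1 : (Fin n → ℂ) → ℂ) p‖ ≤
          if u.length = 0 then 1 else 0 := fun u => by
        rcases eq_or_ne u [] with rfl | hu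
        · simp [der]
        · have : der u (1 : (Fin n → ℂ) → ℂ) = 0 := der_const hu 1
          rw [this]
          simp [hu]
      have key := norm_der_aff_mul_le h1 h2 w.length (f := 1) contDiff_const
        (B := if w.length = 0 then 1 else 0) (B' := if w.length = 1 then 1 else 0)
        (fun u hu => hu ▸ hB u) (fun u hu => by
          refine (hB u).trans_eq ?_
          rw [← hu]
          simp) w rfl
      have e : hermiteMul L q 1 v = aff c b * 1 := by rw [← hcb]; rfl
      rw [e]
      refine key.trans ?_
      have : 0 ≤ Λ * ‖v 0‖ := by positivity
      rcases hd : w.length with _ | _ | d <;> simp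
    | k + 2 =>
      obtain ⟨c, b, hcb, h1, h2⟩ := hL (v 0)
      obtain ⟨a, ha, h3⟩ := hq (v 0) (v 1)
      set X : ℝ := Λ ^ (k + 2) * ∏ i, ‖v i‖ with hX
      have hX0 : 0 ≤ X := by positivity
      have hX1 : X = Λ * ‖v 0‖ * (Λ ^ (k + 1) * ∏ i, ‖Fin.tail v i‖) := by
        rw [hX, Fin.prod_univ_succ]
        simp only [Fin.tail]
        ring
      have hX2 : X = Λ ^ 2 * (‖v 0‖ * ‖v 1‖) *
          (Λ ^ k * ∏ i, ‖Fin.tail (Fin.tail v) i‖) := by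
        rw [hX, Fin.prod_univ_succ, Fin.prod_univ_succ]
        simp only [Fin.tail, Fin.succ_zero_eq_one]
        ring
      set f1 := hermiteMul L q (k + 1) (Fin.tail v)
      set f2 := hermiteMul L q k (Fin.tail (Fin.tail v))
      have i1 := ih (k + 1) (by omega) (Fin.tail v)
      have i2 := ih k (by omega) (Fin.tail (Fin.tail v)) w
      have s1 : ContDiff ℝ ∞ f1 := hsm _ _
      have s2 : ContDiff ℝ ∞ f2 := hsm _ _
      have k1 := norm_der_aff_mul_le h1 h2 w.length s1 (fun u hu => hu ▸ i1 u)
        (B' := if w.length ≤ k + 2 then Λ ^ (k + 1) * ∏ i, ‖Fin.tail v i‖ else 0)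
        (fun u hu => by
          refine (i1 u).trans_eq ?_
          rw [← hu]
          simp) w rfl
      have k1' : ‖der w (aff c b * f1) p‖ ≤ (if w.length ≤ k + 1 then X else 0) +
          w.length * (if w.length ≤ k + 2 then X else 0) := by
        refine k1.trans_eq ?_
        rw [mul_add, mul_left_comm, mul_ite, mul_ite, mul_zero, ← hX1]
      have k2 : ‖(2 : ℂ) • der w ((fun _ => a) * f2) p‖ ≤ if w.length ≤ k then X else 0 := by
        rw [der_const_mul w a s2, norm_smul, Pi.smul_apply, norm_smul, Complex.norm_ofNat,
          ← mul_assoc]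
        refine (mul_le_mul h3 i2 (norm_nonneg _) (by positivity)).trans_eq ?_
        rw [mul_ite, mul_zero, ← hX2]
      have e : der w (hermiteMul L q (k + 2) v) p = ((1 / ((k : ℝ) + 2) : ℝ) : ℂ) *
          (der w (aff c b * f1) p + (2 : ℂ) • der w ((fun _ => a) * f2) p) := by
        have t1 : ContDiff ℝ ∞ (aff c b * f1) := (contDiff_aff c b).mul s1
        have t2 : ContDiff ℝ ∞ ((fun _ => a) * f2) := contDiff_const.mul s2
        have t3 : ContDiff ℝ ∞ ((2 : ℂ) • ((fun _ => a) * f2)) := contDiff_const.smul t2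
        have u := (smoothLinear_der w).2.2 ((1 / ((k : ℝ) + 2) : ℝ) : ℂ)
          (aff c b * f1 + (2 : ℂ) • ((fun _ => a) * f2)) (t1.add t3)
        rw [hermiteMul_add_two, hcb, ha, u, (smoothLinear_der w).2.1 _ _ t1 t3,
          (smoothLinear_der w).2.2 _ _ t2]
        rfl
      have hk : (0 : ℝ) < (k : ℝ) + 2 := by positivity
      rw [e, norm_mul, Complex.norm_real, Real.norm_of_nonneg (by positivity), one_div,
        inv_mul_le_iff₀ hk]
      refine (norm_add_le _ _).trans ((add_le_add k1' k2).trans ?_)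
      -- Counting multiples of `X` for words of length `d`: at most `1 + d + 1` if `d ≤ k`, then `1
      -- + (k + 1)` if `d = k + 1`, then `k + 2` if `d = k + 2`, and none beyond.
      by_cases c1 : w.length ≤ k
      · rw [if_pos (by omega), if_pos (by omega), if_pos c1]
        have : (w.length : ℝ) ≤ k := by exact_mod_cast c1
        nlinarith
      · rw [if_neg c1]
        by_cases c2 : w.length = k + 1
        · rw [c2, if_pos le_rfl, if_pos (by omega)]
          push_cast
          exact le_of_eq (by ring)
        · rw [if_neg (by omega)]
          by_cases c3 : w.length = k + 2
          · rw [c3, if_pos le_rfl]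
            push_cast
            exact le_of_eq (by ring)
          · rw [if_neg (by omega)]
            simp

end HermiteBound

/-! ### Continuity of multilinear maps and the underlying real seminorms. -/

section Continuity

/-- A multilinear map on a finite-dimensional space is continuous. -/
theorem continuous_multilinearMap_of_finiteDimensional {V F : Type*} [NormedAddCommGroup V]
    [NormedSpace ℝ V] [FiniteDimensional ℝ V] [AddCommGroup F] [Module ℝ F] [TopologicalSpace F]
    [IsTopologicalAddGroup F] [ContinuousSMul ℝ F] {k : ℕ}
    (f : MultilinearMap ℝ (fun _ : Fin k => V) F) : Continuous f := by
  set B := Module.finBasis ℝ V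
  -- In a basis, `f` is a finite sum of continuous scalar functions times fixed vectors, so nothing
  -- beyond continuity of the operations of `F` is needed.
  have h : ⇑f = fun v => ∑ r : Fin k → Fin (Module.finrank ℝ V),
      (∏ i, B.repr (v i) (r i)) • f fun i => B (r i) := by
    funext v
    conv_lhs => rw [show v = fun i => ∑ j, B.repr (v i) j • B j from
      funext fun i => (B.sum_repr (v i)).symm]
    rw [f.map_sum]
    exact Finset.sum_congr rfl fun r _ => f.map_smul_univ _ _
  rw [h]
  refine continuous_finsetSum _ fun r _ => Continuous.smul ?_ continuous_const
  refine continuous_finsetProd _ fun i _ => ?_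
  exact (LinearMap.continuous_of_finiteDimensional (B.coord (r i))).comp (continuous_apply i)

theorem withSeminorms_real (hbar : ℝ) (p : Fin n → ℂ) :
    WithSeminorms (fun i : Label n => (WickSpace.seminorm hbar p i).restrictScalars ℝ) := by
  rw [SeminormFamily.withSeminorms_iff_nhds_eq_iInf]
  exact (WickSpace.seminorm hbar p).withSeminorms_iff_nhds_eq_iInf.1 WickSpace.withSeminorms

end Continuity

/-! ### The unitaries and their generators, as elements of `𝒜_ħ` -/

section Elements

/-- The coefficients of the linear form `J_w`. -/
def heisCoef (hbar : ℝ) (w : Fin n → ℂ) : Fin n ⊕ Fin n → ℂ :=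
  Sum.elim (fun k => conj (w k) / (2 * hbar)) fun k => -(w k / (2 * hbar))

/-- The sesquilinear form `-(v̄ w) / 4ħ`. -/
def quad (hbar : ℝ) (v w : Fin n → ℂ) : ℂ := -((∑ k, conj (v k) * w k) / (4 * hbar))

variable {hbar : ℝ}

theorem linFun_eq (hbar : ℝ) (w z : Fin n → ℂ) :
    linFun hbar w z = linForm (heisCoef hbar w) z := by
  rw [linFun, linForm_apply, mul_sub, Finset.mul_sum, Finset.mul_sum, sub_eq_add_neg,
    ← Finset.sum_neg_distrib]
  simp only [heisCoef, Sum.elim_inl, Sum.elim_inr]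
  congr 1 <;> exact Finset.sum_congr rfl fun k _ => by ring

theorem genFun_eq (hbar : ℝ) (x : Heis n) :
    genFun hbar x = aff (heisCoef hbar x.1) (-(Complex.I / (2 * hbar)) * (x.2 : ℂ)) := by
  funext z
  rw [genFun, aff, linFun_eq]

theorem heisFun_eq (h : 0 < hbar) (g : Heis n) (z : Fin n → ℂ) :
    heisFun hbar g z = Complex.exp (quad hbar g.1 g.1 + genFun hbar g z) := by
  have h0 : (hbar : ℂ) ≠ 0 := Complex.ofReal_ne_zero.2 h.ne'
  rw [heisFun, transFun, expFun, ← Complex.exp_add, ← Complex.exp_add, genFun, linFun_eq,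
    linForm_apply]
  congr 1
  simp only [heisCoef, Sum.elim_inl, Sum.elim_inr]
  have : (hbar : ℂ) * ∑ k, conj (g.1 k) / (2 * hbar) * -(g.1 k / (2 * hbar)) =
      quad hbar g.1 g.1 := by
    rw [quad, Finset.mul_sum, Finset.sum_div, ← Finset.sum_neg_distrib]
    refine Finset.sum_congr rfl fun k _ => ?_
    field_simp
    ring
  rw [this]
  ring

theorem heisFun_eq_exp_aff (h : 0 < hbar) (g : Heis n) :
    heisFun hbar g = fun z => Complex.exp (aff (heisCoef hbar g.1)
      (quad hbar g.1 g.1 + -(Complex.I / (2 * hbar)) * (g.2 : ℂ)) z) := by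
  funext z
  rw [heisFun_eq h, genFun_eq, aff, aff, add_assoc]

theorem two_mul_sum_heisCoef (h : 0 < hbar) (v w : Fin n → ℂ) :
    2 * hbar * ∑ k, heisCoef hbar v (.inl k) * heisCoef hbar w (.inr k) =
      2 * quad hbar v w := by
  have h0 : (hbar : ℂ) ≠ 0 := Complex.ofReal_ne_zero.2 h.ne'
  rw [quad, Finset.sum_div, ← Finset.sum_neg_distrib, Finset.mul_sum, Finset.mul_sum]
  refine Finset.sum_congr rfl fun k _ => ?_
  simp only [heisCoef, Sum.elim_inl, Sum.elim_inr]
  field_simp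
  ring

theorem quad_add_left (hbar : ℝ) (v v' w : Fin n → ℂ) :
    quad hbar (v + v') w = quad hbar v w + quad hbar v' w := by
  simp only [quad, Pi.add_apply, map_add, add_mul, Finset.sum_add_distrib]
  ring

theorem quad_add_right (hbar : ℝ) (v w w' : Fin n → ℂ) :
    quad hbar v (w + w') = quad hbar v w + quad hbar v w' := by
  simp only [quad, Pi.add_apply, mul_add, Finset.sum_add_distrib]
  ring

theorem quad_smul_left (hbar t : ℝ) (v w : Fin n → ℂ) :
    quad hbar (t • v) w = t * quad hbar v w := by
  simp only [quad, Pi.smul_apply, Complex.real_smul, map_mul, Complex.conj_ofReal, mul_assoc]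
  rw [← Finset.mul_sum]
  ring

theorem quad_smul_right (hbar t : ℝ) (v w : Fin n → ℂ) :
    quad hbar v (t • w) = t * quad hbar v w := by
  simp only [quad, Pi.smul_apply, Complex.real_smul, mul_left_comm _ (t : ℂ)]
  rw [← Finset.mul_sum]
  ring

/-- Swapping the arguments conjugates the form, so only an imaginary part survives. This is the
source of both the group cocycle and the Lie bracket. -/
theorem quad_sub_quad (h : 0 < hbar) (v w : Fin n → ℂ) :
    quad hbar v w - quad hbar w v = -(Complex.I / (2 * hbar)) * (Heis.im v w : ℂ) := by
  have h0 : (hbar : ℂ) ≠ 0 := Complex.ofReal_ne_zero.2 h.ne'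
  have h1 : ∑ k, conj (w k) * v k = conj (∑ k, conj (v k) * w k) := by
    rw [map_sum]
    exact Finset.sum_congr rfl fun k _ => by rw [map_mul, Complex.conj_conj, mul_comm]
  have h2 := Complex.sub_conj (∑ k, conj (v k) * w k)
  rw [quad, quad, h1, Heis.im]
  push_cast at h2
  field_simp
  linear_combination (-2 : ℂ) * h2

theorem norm_quad_le (h : 0 < hbar) (v w : Fin n → ℂ) :
    ‖quad hbar v w‖ ≤ n / (4 * hbar) * (‖v‖ * ‖w‖) := by
  have h1 : ‖∑ k, conj (v k) * w k‖ ≤ n * (‖v‖ * ‖w‖) := by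
    refine (norm_sum_le _ _).trans ((Finset.sum_le_card_nsmul _ _ (‖v‖ * ‖w‖)
      fun k _ => ?_).trans_eq ?_)
    · rw [norm_mul, RCLike.norm_conj]
      gcongr <;> exact norm_le_pi_norm _ k
    · simp
  rw [quad, norm_neg, norm_div, norm_mul, Complex.norm_real, Real.norm_of_nonneg h.le,
    Complex.norm_ofNat, div_mul_eq_mul_div]
  gcongr

theorem linForm_heisCoef_add (hbar : ℝ) (w w' z : Fin n → ℂ) :
    linForm (heisCoef hbar (w + w')) z =
      linForm (heisCoef hbar w) z + linForm (heisCoef hbar w') z := by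
  rw [← linFun_eq, ← linFun_eq, ← linFun_eq]
  simp only [linFun, Pi.add_apply, map_add, add_mul, Finset.sum_add_distrib]
  ring

theorem linForm_heisCoef_smul (hbar t : ℝ) (w z : Fin n → ℂ) :
    linForm (heisCoef hbar (t • w)) z = t * linForm (heisCoef hbar w) z := by
  rw [← linFun_eq, ← linFun_eq]
  simp only [linFun, Pi.smul_apply, Complex.real_smul, map_mul, Complex.conj_ofReal, mul_assoc]
  rw [← Finset.mul_sum, ← Finset.mul_sum]
  ring

theorem genFun_add (hbar : ℝ) (x y : Heis n) :
    genFun hbar (x + y) = genFun hbar x + genFun hbar y := by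
  funext z
  simp only [genFun_eq, aff, Pi.add_apply]
  rw [show (x + y).1 = x.1 + y.1 from rfl, show (x + y).2 = x.2 + y.2 from rfl,
    linForm_heisCoef_add]
  push_cast
  ring

theorem genFun_smul (hbar t : ℝ) (x : Heis n) :
    genFun hbar (t • x) = (t : ℂ) • genFun hbar x := by
  funext z
  simp only [genFun_eq, aff, Pi.smul_apply, smul_eq_mul]
  rw [show (t • x).1 = t • x.1 from rfl, show (t • x).2 = t * x.2 from rfl,
    linForm_heisCoef_smul]
  push_cast
  ring

theorem isExpType_heisFun (h : 0 < hbar) (p : Fin n → ℂ) (g : Heis n) :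
    IsExpType p (heisFun hbar g) := by
  rw [heisFun_eq_exp_aff h]
  exact isExpType_exp_aff _ _ p

theorem isExpType_genFun (hbar : ℝ) (p : Fin n → ℂ) (x : Heis n) :
    IsExpType p (genFun hbar x) := by
  rw [genFun_eq]
  exact isTower_id.isExpType 0 _ _ p

/-- The element `u_{(w,c)}` of `𝒜_ħ`. -/
def heisElem (h : 0 < hbar) (p : Fin n → ℂ) (g : Heis n) : WickSpace hbar p :=
  WickSpace.ofExpType hbar (heisFun hbar g) (isExpType_heisFun h p g)

/-- The element `J_{(w,c)}` of `𝒜_ħ`. -/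
def genElem (hbar : ℝ) (p : Fin n → ℂ) (x : Heis n) : WickSpace hbar p :=
  WickSpace.ofExpType hbar (genFun hbar x) (isExpType_genFun hbar p x)

theorem coe_heisElem (h : 0 < hbar) (p : Fin n → ℂ) (g : Heis n) :
    ⇑(heisElem h p g) = heisFun hbar g := rfl

theorem coe_genElem (hbar : ℝ) (p : Fin n → ℂ) (x : Heis n) :
    ⇑(genElem hbar p x) = genFun hbar x := rfl

end Elements

/-! ### The group morphism and the Lie algebra morphism -/

section Morphism

variable {hbar : ℝ} (h : 0 < hbar) (p : Fin n → ℂ)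
include h

theorem heisElem_one (z : Fin n → ℂ) : heisElem h p 1 z = 1 := by
  rw [coe_heisElem, heisFun_eq h, genFun_eq]
  have h1 : (1 : Heis n).1 = 0 := rfl
  have h2 : (1 : Heis n).2 = 0 := rfl
  have h3 := linForm_heisCoef_smul hbar 0 0 z
  rw [zero_smul, Complex.ofReal_zero, zero_mul] at h3
  simp [h1, h2, aff, h3, quad]

theorem isStarProduct_heisElem (g g' : Heis n) :
    IsStarProduct (heisElem h p g) (heisElem h p g') (heisElem h p (g * g')) := by
  refine isStarProduct_exp (heisFun_eq_exp_aff h g) (heisFun_eq_exp_aff h g') fun z => ?_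
  rw [two_mul_sum_heisCoef h, coe_heisElem, heisFun_eq_exp_aff h, ← Complex.exp_add,
    ← Complex.exp_add]
  refine congrArg Complex.exp ?_
  have h1 : (g * g').1 = g.1 + g'.1 := rfl
  have h2 : (g * g').2 = g.2 + g'.2 + Heis.im g.1 g'.1 := rfl
  have h3 := quad_sub_quad h g.1 g'.1
  simp only [h1, h2, aff, linForm_heisCoef_add, quad_add_left, quad_add_right]
  push_cast
  linear_combination -h3

/-- In the exponent the quadratic part is real and even, the rest imaginary and odd. Conjugation is
therefore group inversion, and unitarity follows from the morphism property. -/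
theorem heisElem_inv (g : Heis n) (z : Fin n → ℂ) :
    heisElem h p g⁻¹ z = conj (heisElem h p g z) := by
  have h1 : (g⁻¹).1 = -g.1 := rfl
  have h2 : (g⁻¹).2 = -g.2 := rfl
  rw [coe_heisElem, coe_heisElem, heisFun_eq h, heisFun_eq h, ← Complex.exp_conj, genFun,
    genFun, h1, h2]
  congr 1
  simp only [quad, linFun, map_add, map_neg, map_div₀, map_sum, map_mul, map_sub,
    Complex.conj_conj, Complex.conj_ofReal, Complex.conj_I, map_one, map_ofNat, Pi.neg_apply,
    neg_mul, mul_neg, neg_neg, Finset.sum_neg_distrib, Complex.ofReal_neg]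
  simp only [mul_comm (g.1 _) (conj (g.1 _))]
  ring

theorem isUnitary_heisElem (g : Heis n) : IsUnitary (heisElem h p g) := by
  refine ⟨heisElem h p g⁻¹, heisElem h p 1, heisElem_inv h p g, heisElem_one h p, ?_, ?_⟩
  · have := isStarProduct_heisElem h p g⁻¹ g
    rwa [inv_mul_cancel] at this
  · have := isStarProduct_heisElem h p g g⁻¹
    rwa [mul_inv_cancel] at this

omit h in
theorem isLinearMap_genElem : IsLinearMap ℝ (genElem (n := n) hbar p) where
  map_add x y := DFunLike.coe_injective (genFun_add hbar x y)
  map_smul t x := DFunLike.coe_injective (genFun_smul hbar t x)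

theorem exists_isStarProduct_genElem (x y : Heis n) : ∃ a : WickSpace hbar p,
    IsStarProduct (genElem hbar p x) (genElem hbar p y) a ∧
    ∀ z, a z = genFun hbar x z * genFun hbar y z + 2 * quad hbar x.1 y.1 := by
  have h1 : IsExpType p (genFun hbar x * genFun hbar y) :=
    (isExpType_genFun hbar p x).mul (isExpType_genFun hbar p y)
  -- The constant is realised as a multiple of `u_{(0,0)} = 1`.
  have h2 : IsExpType p ((2 * quad hbar x.1 y.1) • heisFun hbar (1 : Heis n)) :=
    (isExpType_heisFun h p 1).smul _
  set a : WickSpace hbar p := WickSpace.ofExpType hbar _ h1 + WickSpace.ofExpType hbar _ h2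
  have ha : ∀ z, a z = genFun hbar x z * genFun hbar y z + 2 * quad hbar x.1 y.1 := by
    intro z
    change _ + 2 * quad hbar x.1 y.1 * heisElem h p 1 z = _
    rw [heisElem_one, mul_one]
    rfl
  refine ⟨a, isStarProduct_of_tower isTower_id isTower_id (fun j _ _ => zero_mul _)
    (genFun_eq hbar x) (genFun_eq hbar y) fun z => ?_, ha⟩
  rw [two_mul_sum_heisCoef h, ha, genFun_eq, genFun_eq]
  simp [idTower]

theorem isStarCommutator_genElem (x y : Heis n) :
    IsStarCommutator (genElem hbar p x) (genElem hbar p y) (genElem hbar p ⁅x, y⁆) := by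
  obtain ⟨a, ha, ha'⟩ := exists_isStarProduct_genElem h p x y
  obtain ⟨b, hb, hb'⟩ := exists_isStarProduct_genElem h p y x
  refine ⟨a, b, ha, hb, DFunLike.coe_injective ?_⟩
  funext z
  rw [WickSpace.coe_sub, Pi.sub_apply, ha', hb', coe_genElem, genFun_eq, aff]
  have h1 : (⁅x, y⁆ : Heis n).1 = 0 := rfl
  have h2 : (⁅x, y⁆ : Heis n).2 = 2 * Heis.im x.1 y.1 := rfl
  have h3 := linForm_heisCoef_smul hbar 0 0 z
  rw [zero_smul, Complex.ofReal_zero, zero_mul] at h3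
  rw [h1, h2, h3]
  push_cast
  linear_combination -2 * quad_sub_quad h x.1 y.1

end Morphism

/-! ### One-parameter groups -/

section OneParameter

variable {hbar : ℝ} (p : Fin n → ℂ)

/-- The `k`-th derivative of the one-parameter group `t ↦ u_{tx}`. -/
def curveDeriv (hbar : ℝ) (p : Fin n → ℂ) (x : Heis n) (k : ℕ) (t : ℝ) : WickSpace hbar p :=
  WickSpace.ofExpType hbar
    (fun z => gauss (quad hbar x.1 x.1) k 0 t
      (aff (heisCoef hbar x.1) (-(Complex.I / (2 * hbar)) * (x.2 : ℂ)) z))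
    ((isTower_gauss _ k t).isExpType 0 _ _ p)

theorem coe_curveDeriv (x : Heis n) (k : ℕ) (t : ℝ) : ⇑(curveDeriv hbar p x k t) =
    fun z => gauss (quad hbar x.1 x.1) k 0 t
      (aff (heisCoef hbar x.1) (-(Complex.I / (2 * hbar)) * (x.2 : ℂ)) z) := rfl

theorem curveDeriv_zero (h : 0 < hbar) (x : Heis n) (t : ℝ) :
    curveDeriv hbar p x 0 t = heisElem h p (t • x) := by
  apply DFunLike.coe_injective
  funext z
  rw [coe_heisElem, heisFun_eq h, genFun_smul, genFun_eq, coe_curveDeriv]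
  beta_reduce
  rw [gauss_zero_zero, show (t • x).1 = t • x.1 from rfl, quad_smul_left, quad_smul_right, Pi.smul_apply,
    smul_eq_mul]
  ring_nf

theorem curveDeriv_one_zero (x : Heis n) : curveDeriv hbar p x 1 0 = genElem hbar p x := by
  apply DFunLike.coe_injective
  funext z
  rw [coe_genElem, genFun_eq, coe_curveDeriv]
  simp [gauss]

theorem hasDerivAt_curveDeriv (x : Heis n) (k : ℕ) (t : ℝ) :
    HasDerivAt (curveDeriv hbar p x k) (curveDeriv hbar p x (k + 1) t) t :=
  hasDerivAt_gauss_comp_aff _ _ _ k (coe_curveDeriv p x k) (coe_curveDeriv p x (k + 1)) t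

theorem isIteratedDerivs_curveDeriv (h : 0 < hbar) (x : Heis n) :
    IsIteratedDerivs (fun t : ℝ => heisElem h p (t • x)) (curveDeriv hbar p x) :=
  ⟨funext (curveDeriv_zero p h x), hasDerivAt_curveDeriv p x⟩

/-- At `τ = 0` the recursion defining `gauss (k + 1) 0` reads `x P_k + 2q P_k'`, exactly the two
surviving orders of the star product. The contraction of `J_x` with itself is `2q` on either side.
-/
theorem isStarPowers_curveDeriv (h : 0 < hbar) (x : Heis n) :
    IsStarPowers (genElem hbar p x) fun k => curveDeriv hbar p x k 0 := by
  refine ⟨fun z => ?_, curveDeriv_one_zero p x, fun k => ⟨?_, ?_⟩⟩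
  · rw [coe_curveDeriv]
    simp [gauss]
  · refine isStarProduct_of_tower isTower_id (isTower_gauss _ k (0 : ℝ))
      (fun j _ _ => zero_mul _) (genFun_eq hbar x) (coe_curveDeriv p x k 0) fun z => ?_
    rw [two_mul_sum_heisCoef h, coe_curveDeriv]
    simp [gauss, idTower]
  · refine isStarProduct_of_tower (isTower_gauss _ k (0 : ℝ)) isTower_id
      (fun j _ _ => mul_zero _) (coe_curveDeriv p x k 0) (genFun_eq hbar x) fun z => ?_
    rw [two_mul_sum_heisCoef h, coe_curveDeriv]
    simp [gauss, idTower, mul_comm]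

theorem hasSum_curveDeriv (h : 0 < hbar) (x : Heis n) (t : ℝ) :
    HasSum (fun k : ℕ => (t ^ k / (k.factorial : ℝ)) • curveDeriv hbar p x k 0)
      (heisElem h p (t • x)) := by
  refine hasSum_gauss_mul (quad hbar x.1 x.1) t (heisCoef hbar x.1)
    (-(Complex.I / (2 * hbar)) * (x.2 : ℂ)) (isExpType_heisFun h p 1) (fun k z => ?_) fun z => ?_
  · have := heisElem_one h p z
    rw [coe_heisElem] at this
    rw [WickSpace.coe_real_smul, coe_curveDeriv, this]
    simp
  · have := heisElem_one h p z
    rw [coe_heisElem] at this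
    rw [← curveDeriv_zero, coe_curveDeriv, this, mul_one]

theorem curveDeriv_apply_of_snd_eq_zero (w : Fin n → ℂ) (k : ℕ) (z : Fin n → ℂ) :
    curveDeriv hbar p (Heis.mk w 0) k 0 z = ∑ l ∈ Finset.range (k / 2 + 1),
      (k.factorial : ℂ) / ((l.factorial : ℂ) * ((k - 2 * l).factorial : ℂ)) *
        (-((∑ i, star (w i) * w i) / (4 * hbar))) ^ l * linFun hbar w z ^ (k - 2 * l) := by
  have h1 : (Heis.mk w 0 : Heis n).1 = w := rfl
  have h2 : (Heis.mk w 0 : Heis n).2 = 0 := rfl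
  rw [coe_curveDeriv, h1, h2]
  beta_reduce
  rw [aff, ← linFun_eq]
  simp only [Complex.ofReal_zero, mul_zero, zero_add]
  rw [gauss_eq_hermiteSum, hermiteSum, Finset.mul_sum]
  refine Finset.sum_congr rfl fun l _ => ?_
  simp only [quad, starRingEnd_apply]
  ring

end OneParameter

/-! ### Analyticity -/

section Analyticity

variable {hbar : ℝ}

instance : FiniteDimensional ℝ (Heis n) :=
  inferInstanceAs (FiniteDimensional ℝ ((Fin n → ℂ) × ℝ))

/-- The part of the exponent of `u_{g+y}` that is linear in `y`. -/
def expLin (hbar : ℝ) (g : Heis n) : Heis n →ₗ[ℝ] (Fin n → ℂ) → ℂ where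
  toFun y := aff (heisCoef hbar y.1) (-(Complex.I / (2 * hbar)) * (y.2 : ℂ) +
    (quad hbar g.1 y.1 + quad hbar y.1 g.1))
  map_add' x y := by
    funext z
    simp only [aff, Pi.add_apply]
    rw [show (x + y).1 = x.1 + y.1 from rfl, show (x + y).2 = x.2 + y.2 from rfl,
      linForm_heisCoef_add, quad_add_left, quad_add_right]
    push_cast
    ring
  map_smul' t x := by
    funext z
    simp only [aff, Pi.smul_apply, Complex.real_smul, RingHom.id_apply]
    rw [show (t • x).1 = t • x.1 from rfl, show (t • x).2 = t * x.2 from rfl,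
      linForm_heisCoef_smul, quad_smul_left, quad_smul_right]
    push_cast
    ring

/-- The bilinear map whose diagonal is the quadratic part of the exponent of `u_y`. -/
def expQuad (n : ℕ) (hbar : ℝ) : Heis n →ₗ[ℝ] Heis n →ₗ[ℝ] (Fin n → ℂ) → ℂ :=
  LinearMap.mk₂ ℝ (fun y y' _ => quad hbar y.1 y'.1)
    (fun _ _ _ => funext fun _ => quad_add_left hbar _ _ _)
    (fun _ _ _ => funext fun _ => quad_smul_left hbar _ _ _)
    (fun _ _ _ => funext fun _ => quad_add_right hbar _ _ _)
    (fun _ _ _ => funext fun _ => quad_smul_right hbar _ _ _)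

theorem expQuad_apply (y y' : Heis n) : expQuad n hbar y y' = fun _ => quad hbar y.1 y'.1 := rfl

theorem expLin_apply (g y : Heis n) : expLin hbar g y =
    aff (heisCoef hbar y.1) (-(Complex.I / (2 * hbar)) * (y.2 : ℂ) +
      (quad hbar g.1 y.1 + quad hbar y.1 g.1)) := rfl

/-- The sum is that of the vector space, not the group product, so the cross terms `q(g, y) + q(y,
g)` join the linear part. -/
theorem heisFun_add (h : 0 < hbar) (g y : Heis n) (z : Fin n → ℂ) :
    heisFun hbar (g + y) z =
      gauss (quad hbar y.1 y.1) 0 0 1 (expLin hbar g y z) * heisFun hbar g z := by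
  rw [heisFun_eq h, heisFun_eq h, gauss_zero_zero, ← Complex.exp_add, genFun_add, expLin_apply,
    show (g + y).1 = g.1 + y.1 from rfl, quad_add_left, quad_add_right, quad_add_right,
    Pi.add_apply, genFun_eq hbar y, aff, aff]
  congr 1
  ring

theorem exists_norm_linearMap_le {F : Type*} [NormedAddCommGroup F] [NormedSpace ℝ F]
    (f : Heis n →ₗ[ℝ] F) : ∃ C : ℝ, 0 ≤ C ∧ ∀ y, ‖f y‖ ≤ C * ‖y‖ :=
  ⟨‖LinearMap.toContinuousLinearMap f‖, norm_nonneg _,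
    (LinearMap.toContinuousLinearMap f).le_opNorm⟩

theorem norm_fst_le' (y : Heis n) : ‖y.1‖ ≤ ‖y‖ := norm_fst_le (E := Fin n → ℂ) (F := ℝ) y

theorem norm_heisCoef_le (h : 0 < hbar) (w : Fin n → ℂ) (x : Fin n ⊕ Fin n) :
    ‖heisCoef hbar w x‖ ≤ 1 / (2 * hbar) * ‖w‖ := by
  rw [div_mul_eq_mul_div, one_mul]
  cases x with
  | inl k =>
    rw [heisCoef, Sum.elim_inl, norm_div, RCLike.norm_conj, norm_mul, Complex.norm_real,
      Real.norm_of_nonneg h.le, Complex.norm_ofNat]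
    gcongr
    exact norm_le_pi_norm w k
  | inr k =>
    rw [heisCoef, Sum.elim_inr, norm_neg, norm_div, norm_mul, Complex.norm_real,
      Real.norm_of_nonneg h.le, Complex.norm_ofNat]
    gcongr
    exact norm_le_pi_norm w k

theorem exists_norm_der_hermiteMul_le (h : 0 < hbar) (p : Fin n → ℂ) (g : Heis n) :
    ∃ Λ : ℝ, 0 < Λ ∧ ∀ (k : ℕ) (v : Fin k → Heis n) (w : List (Fin n ⊕ Fin n)),
      ‖der w (hermiteMul (expLin hbar g) (expQuad n hbar) k v) p‖ ≤
        (Λ ^ k * ∏ i, ‖v i‖) * 1 ^ w.length := by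
  obtain ⟨C, hC0, hC⟩ := exists_norm_linearMap_le ((LinearMap.proj p).comp (expLin hbar g))
  -- The summands bound the value of the linear part at `p`, its coefficients and twice the
  -- quadratic form. The leading `1` ensures `Λ ≤ Λ²`.
  set Λ : ℝ := 1 + (C + 1 / (2 * hbar) + 2 * (n / (4 * hbar))) with hΛ
  have c1 : 0 ≤ 1 / (2 * hbar) := by positivity
  have c2 : 0 ≤ 2 * (n / (4 * hbar)) := by positivity
  have hΛ1 : 1 ≤ Λ := by linarith
  refine ⟨Λ, by linarith, fun k v w => ?_⟩
  refine (norm_der_hermiteMul_le (expLin hbar g) (expQuad n hbar) (zero_le_one.trans hΛ1)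
    (fun y => ⟨_, _, expLin_apply g y, fun x => ?_, ?_⟩)
    (fun y y' => ⟨_, expQuad_apply y y', ?_⟩) k v w).trans ?_
  · refine (norm_heisCoef_le h y.1 x).trans ?_
    exact mul_le_mul (by linarith) (norm_fst_le' y) (norm_nonneg _) (by linarith)
  · refine (hC y).trans ?_
    exact mul_le_mul_of_nonneg_right (by linarith) (norm_nonneg _)
  · have hm : ‖y.1‖ * ‖y'.1‖ ≤ ‖y‖ * ‖y'‖ :=
      mul_le_mul (norm_fst_le' y) (norm_fst_le' y') (norm_nonneg _) (norm_nonneg _)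
    calc 2 * ‖quad hbar y.1 y'.1‖ ≤ 2 * (n / (4 * hbar) * (‖y.1‖ * ‖y'.1‖)) := by
          gcongr
          exact norm_quad_le h _ _
      _ = 2 * (n / (4 * hbar)) * (‖y.1‖ * ‖y'.1‖) := by ring
      _ ≤ Λ ^ 2 * (‖y‖ * ‖y'‖) := by
          refine mul_le_mul ?_ hm (by positivity) (by positivity)
          nlinarith
  · have : 0 ≤ Λ ^ k * ∏ i, ‖v i‖ := by positivity
    rw [one_pow, mul_one]
    split_ifs
    · exact le_rfl
    · exact this

theorem analyticOnNhd_hermiteMul_exp (hbar : ℝ) (g : Heis n) (k : ℕ) (v : Fin k → Heis n) :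
    AnalyticOnNhd ℝ (hermiteMul (expLin hbar g) (expQuad n hbar) k v) Set.univ := by
  refine analyticOnNhd_hermiteMul _ _ (fun y => ?_) (fun y y' => ?_) k v
  · rw [expLin_apply]
    exact analyticOnNhd_comp_aff _ _ differentiable_id
  · exact fun z _ => analyticAt_const

theorem isExpType_hermiteMul_mul (h : 0 < hbar) (p : Fin n → ℂ) (g : Heis n) (k : ℕ)
    (v : Fin k → Heis n) :
    IsExpType p (hermiteMul (expLin hbar g) (expQuad n hbar) k v * heisFun hbar g) := by
  obtain ⟨Λ, -, hb⟩ := exists_norm_der_hermiteMul_le h p g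
  exact IsExpType.mul ⟨analyticOnNhd_hermiteMul_exp hbar g k v, _, 1, zero_le_one, hb k v⟩
    (isExpType_heisFun h p g)

/-- The power series of `g ↦ u_g` at `g`. -/
def heisSeries (h : 0 < hbar) (p : Fin n → ℂ) (g : Heis n) :
    FormalMultilinearSeries ℝ (Heis n) (WickSpace hbar p) := fun k =>
  let f : MultilinearMap ℝ (fun _ : Fin k => Heis n) (WickSpace hbar p) :=
    { toFun := fun v => WickSpace.ofExpType hbar _ (isExpType_hermiteMul_mul h p g k v)
      map_update_add' := fun v i x y => DFunLike.coe_injective (by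
        rw [WickSpace.coe_add]
        simp only [WickSpace.coe_ofExpType, MultilinearMap.map_update_add, add_mul])
      map_update_smul' := fun v i c x => DFunLike.coe_injective (by
        rw [WickSpace.coe_real_smul]
        simp only [WickSpace.coe_ofExpType, MultilinearMap.map_update_smul, smul_mul_assoc]
        rfl) }
  ⟨f, continuous_multilinearMap_of_finiteDimensional f⟩

theorem coe_heisSeries (h : 0 < hbar) (p : Fin n → ℂ) (g : Heis n) (k : ℕ)
    (v : Fin k → Heis n) : ⇑(heisSeries h p g k v) =
      hermiteMul (expLin hbar g) (expQuad n hbar) k v * heisFun hbar g := rfl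

theorem isRealAnalyticAt_heisElem (h : 0 < hbar) (p : Fin n → ℂ) (g : Heis n) :
    IsRealAnalyticAt (heisElem h p) g := by
  obtain ⟨Λ, hΛ, hb⟩ := exists_norm_der_hermiteMul_le h p g
  refine ⟨heisSeries h p g, 1 / Λ, by positivity, fun q hq => ?_, fun y _ => ?_⟩
  · obtain ⟨s, A, -, hA⟩ := Seminorm.bound_of_continuous (withSeminorms_real hbar p) q hq
    obtain ⟨-, D, σ, hσ, hD⟩ := isExpType_heisFun h p g
    have hD0 : 0 ≤ D := by simpa [der] using (norm_nonneg _).trans (hD [])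
    choose K hK0 hK using fun i : Label n =>
      WickSpace.exists_seminorm_le (hbar := hbar) (p := p) i
        (show (0 : ℝ) ≤ 1 + σ by positivity)
    -- A continuous seminorm is dominated by `A` times a finite supremum of defining ones; the sum
    -- of the `K i` dominates each of them.
    refine ⟨A * ((∑ i ∈ s, K i) * D), fun k v => ?_⟩
    have hprod : ∏ i, (‖v i‖ / (1 / Λ)) = Λ ^ k * ∏ i, ‖v i‖ := by
      simp [div_eq_mul_inv, Finset.prod_mul_distrib, mul_comm]
    have hX0 : 0 ≤ Λ ^ k * ∏ i, ‖v i‖ := by positivity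
    rw [hprod, mul_assoc, mul_assoc]
    refine (hA _).trans ?_
    rw [smul_apply, NNReal.smul_def, smul_eq_mul]
    refine mul_le_mul_of_nonneg_left ?_ A.2
    refine Seminorm.finset_sup_apply_le
      (mul_nonneg (Finset.sum_nonneg fun i _ => hK0 i) (by positivity)) fun i hi => ?_
    change WickSpace.seminorm hbar p i _ ≤ _
    refine (hK i _ ((Λ ^ k * ∏ i, ‖v i‖) * D) fun w => ?_).trans ?_
    · rw [WickSpace.derₗ_apply, coe_heisSeries]
      exact norm_der_mul_le (analyticOnNhd_hermiteMul_exp hbar g k v).contDiff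
        (isExpType_heisFun h p g).contDiff (hb k v) hD w
    · rw [mul_comm D]
      exact mul_le_mul_of_nonneg_right (Finset.single_le_sum (fun j _ => hK0 j) hi)
        (mul_nonneg hX0 hD0)
  -- The series converges for every `y`; the radius `1/Λ` is needed only for the Cauchy estimates.
  · refine hasSum_gauss_mul (quad hbar y.1 y.1) 1 (heisCoef hbar y.1) _
      (isExpType_heisFun h p g) (fun k z => ?_) (fun z => heisFun_add h g y z)
    rw [coe_heisSeries, Pi.mul_apply, hermiteMul_diag, one_pow]
    rfl

end Analyticity

end Wick

end

theorem mainTheorem8 (n : ℕ) (hbar : ℝ) (hbar_pos : 0 < hbar) (p : Fin n → ℂ) :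
    ∃ U J : Wick.Heis n → Wick.WickSpace hbar p,
      -- the elements `u_{(w,c)}` and `J_{(w,c)}` of `𝒜_ħ`
      (∀ g, ⇑(U g) = Wick.heisFun hbar g) ∧
      (∀ x, ⇑(J x) = Wick.genFun hbar x) ∧
      -- `g ↦ u_g` is a group morphism into the unitaries
      (∀ g, Wick.IsUnitary (U g)) ∧
      (∀ z, U 1 z = 1) ∧
      (∀ g h, Wick.IsStarProduct (U g) (U h) (U (g * h))) ∧
      -- it is real-analytic
      (∀ g, Wick.IsRealAnalyticAt U g) ∧
      -- `J_{(w,c)}` is the generator of the one-parameter group `t ↦ u_{(tw,tc)}`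
      (∀ w c, HasDerivAt (fun t : ℝ => U (Wick.Heis.mk (t • w) (t * c)))
        (J (Wick.Heis.mk w c)) 0) ∧
      -- `x ↦ J_x` is a Lie algebra morphism
      IsLinearMap ℝ J ∧
      (∀ x y, Wick.IsStarCommutator (J x) (J y) (J ⁅x, y⁆)) ∧
      -- the derivatives at `t = 0` are the star powers of the generator;
      -- for `c = 0` there is the explicit formula, and the star exponential converges
      (∀ w c, ∃ (P : ℕ → Wick.WickSpace hbar p) (D : ℕ → ℝ → Wick.WickSpace hbar p),
        Wick.IsStarPowers (J (Wick.Heis.mk w c)) P ∧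
        Wick.IsIteratedDerivs (fun t : ℝ => U (Wick.Heis.mk (t • w) (t * c))) D ∧
        (∀ k, D k 0 = P k) ∧
        (c = 0 →
          (∀ k z, D k 0 z = ∑ l ∈ Finset.range (k / 2 + 1),
            (k.factorial : ℂ) / ((l.factorial : ℂ) * ((k - 2 * l).factorial : ℂ)) *
              (-((∑ i, star (w i) * w i) / (4 * hbar))) ^ l *
              Wick.linFun hbar w z ^ (k - 2 * l)) ∧
          ∀ t : ℝ, HasSum (fun k : ℕ => (t ^ k / (k.factorial : ℝ)) • P k)
            (U (Wick.Heis.mk (t • w) 0)))) := by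
  refine ⟨Wick.heisElem hbar_pos p, Wick.genElem hbar p, fun g => rfl, fun x => rfl,
    Wick.isUnitary_heisElem hbar_pos p, Wick.heisElem_one hbar_pos p,
    Wick.isStarProduct_heisElem hbar_pos p, Wick.isRealAnalyticAt_heisElem hbar_pos p,
    fun w c => ?_, Wick.isLinearMap_genElem p, Wick.isStarCommutator_genElem hbar_pos p,
    fun w c => ⟨fun k => Wick.curveDeriv hbar p (Wick.Heis.mk w c) k 0,
      Wick.curveDeriv hbar p (Wick.Heis.mk w c),
      Wick.isStarPowers_curveDeriv p hbar_pos (Wick.Heis.mk w c),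
      Wick.isIteratedDerivs_curveDeriv p hbar_pos (Wick.Heis.mk w c), fun k => rfl, ?_⟩⟩
  · have h := Wick.hasDerivAt_curveDeriv (hbar := hbar) p (Wick.Heis.mk w c) 0 0
    rw [zero_add, Wick.curveDeriv_one_zero] at h
    have e : Wick.curveDeriv hbar p (Wick.Heis.mk w c) 0 =
        fun t : ℝ => Wick.heisElem hbar_pos p (Wick.Heis.mk (t • w) (t * c)) :=
      (Wick.isIteratedDerivs_curveDeriv p hbar_pos (Wick.Heis.mk w c)).1
    rwa [e] at h
  · rintro rfl
    refine ⟨Wick.curveDeriv_apply_of_snd_eq_zero p w, fun t => ?_⟩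
    have h := Wick.hasSum_curveDeriv p hbar_pos (Wick.Heis.mk w 0) t
    have e : t • Wick.Heis.mk w 0 = Wick.Heis.mk (t • w) 0 :=
      Prod.ext rfl (mul_zero t)
    rwa [e] at h
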